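/- **Setting.** Let $\mathbb T^2=\mathbb R^2/\mathbb Z^2$ carry normalised Lebesgue measure, and let $\widehat f(n)=\int_{[0,1]^2}e^{-2\pi i x\cdot n}f(x)\,dx$ for $n\in\mathbb Z^2$. Fix $C>0$ and consider $\alpha=(\alpha_1,\alpha_2)$ with $\frac1C<\alpha_j<C$ for $j=1,2$. Put $Q(n)=\alpha_1n_1^2+\alpha_2n_2^2$ and, for $f\in L^2(\mathbb T^2)$, $$(e^{it\Delta}f)(x)=\sum_{n\in\mathbb Z^2}\widehat f(n)\,e^{2\pi i(n\cdot x+Q(n)t)}$$ (convergence in $L^2(\mathbb T^2)$); this is the linear Schrödinger evolution on the flat, possibly irrational, torus with parameters $\alpha$, after rescaling to $\mathbb T^2$. For $\mathcal S\subseteq\mathbb Z^2$ let $P_{\mathcal S}$ be the Fourier multiplier on $L^2(\mathbb T^2)$ whose symbol is the characteristic function of $\mathcal S$. For real $N,M\ge1$ let $\mathscr R_{N,M}$ be the collection of all $\mathcal R\subseteq\mathbb Z^2$ for which there are $z\in\mathbb Z^2$ and an orthogonal $2\times2$ matrix $O$ with $O\mathcal R+z\subseteq[-N,N]\times[-M,M]$,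 and set $\mathscr C_N=\mathscr R_{N,N}$. Let $\tau_0\subseteq[0,1]$ be an interval. **Corollary.** Let $6<p\le\infty$ (with $\frac2\infty=0$). 1. There is a constant $c>0$ depending only on $C,\tau_0,p$ such that for every such $\alpha$, every $N\ge1$, every $\mathcal C\in\mathscr C_N$ and every $\phi\in L^2(\mathbb T^2)$, $$\|P_{\mathcal C}e^{it\Delta}\phi\|_{L^p(\tau_0,L^6(\mathbb T^2))}\le c\,N^{\frac23-\frac2p}\|P_{\mathcal C}\phi\|_{L^2(\mathbb T^2)}.$$ 2. Let $6\le q<p$. There is a constant $c>0$ depending only on $C,\tau_0,p,q$ such that for every such $\alpha$, all $N\ge M\ge1$, every $\mathcal R\in\mathscr R_{N,M}$ and every $\phi\in L^2(\mathbb T^2)$, $$\|P_{\mathcal R}e^{it\Delta}\phi\|_{L^p(\tau_0,L^q(\mathbb T^2))}\le c\,N^{\frac12+\frac1q-\frac2p}M^{\frac12-\frac3q}\|P_{\mathcal R}\phi\|_{L^2(\mathbb T^2)}.$$ -/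

import Mathlib

open MeasureTheory Matrix
open scoped ENNReal

noncomputable section

/-- Normalised Lebesgue measure on the two-dimensional torus `𝕋² = ℝ² / ℤ²`. It is the measure
with respect to which the Fourier library defines `mFourierCoeff` and `mFourierLp`. -/
abbrev torusMeasure : Measure (UnitAddTorus (Fin 2)) :=
  Measure.pi fun _ : Fin 2 => AddCircle.haarAddCircle

/-- The Hilbert space `L²(𝕋²)`. -/
abbrev L2Torus : Type := Lp ℂ 2 torusMeasure

/-- The spatial Fourier coefficient `∫_{𝕋²} e^{-2πi x·n} f(x) dx`. -/
def torusCoeff (f : L2Torus) (n : Fin 2 → ℤ) : ℂ := UnitAddTorus.mFourierCoeff (⇑f) n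

/-- The character `x ↦ e^{2πi n·x}` as an element of `L²(𝕋²)`. -/
def torusChar (n : Fin 2 → ℤ) : L2Torus := UnitAddTorus.mFourierLp 2 n

/-- The Fourier multiplier with symbol `m`, that is `f ↦ ∑ₙ m(n) f̂(n) e^{2πi n·x}`, the series
being taken in `L²(𝕋²)`. -/
def fourierMultiplier (m : (Fin 2 → ℤ) → ℂ) (f : L2Torus) : L2Torus :=
  ∑' n : Fin 2 → ℤ, (m n * torusCoeff f n) • torusChar n

/-- For a bounded symbol the series defining the Fourier multiplier converges in `L²(𝕋²)`. -/
theorem hasSum_fourierMultiplier {m : (Fin 2 → ℤ) → ℂ} {B : ℝ} (hm : ∀ n, ‖m n‖ ≤ B)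
    (f : L2Torus) :
    HasSum (fun n => (m n * torusCoeff f n) • torusChar n) (fourierMultiplier m f) := by
  have hc : Memℓp (fun n => m n * torusCoeff f n) 2 := by
    have h0 : Memℓp (fun n => torusCoeff f n) 2 := by
      have h := lp.memℓp (UnitAddTorus.mFourierBasis.repr f)
      refine (congrArg (fun g : (Fin 2 → ℤ) → ℂ => Memℓp g 2) ?_).mp h
      funext n
      exact UnitAddTorus.mFourierBasis_repr f n
    rw [memℓp_gen_iff (by norm_num)] at h0 ⊢
    refine Summable.of_nonneg_of_le (fun _ => by positivity) (fun n => ?_) (h0.mul_left (B ^ 2))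
    have hB : ‖m n‖ ^ 2 ≤ B ^ 2 := pow_le_pow_left₀ (norm_nonneg _) (hm n) 2
    simp only [ENNReal.toReal_ofNat, Real.rpow_ofNat, norm_mul, mul_pow]
    exact mul_le_mul_of_nonneg_right hB (by positivity)
  have hs := UnitAddTorus.mFourierBasis.hasSum_repr_symm
    (⟨fun n => m n * torusCoeff f n, hc⟩ : lp (fun _ : Fin 2 → ℤ => ℂ) 2)
  rw [UnitAddTorus.coe_mFourierBasis] at hs
  exact Summable.hasSum ⟨_, hs⟩

open Classical in
/-- The projection `P_S`: the Fourier multiplier whose symbol is the characteristic function of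
`S ⊆ ℤ²`. -/
def freqProj (S : Set (Fin 2 → ℤ)) : L2Torus → L2Torus :=
  fourierMultiplier fun n => if n ∈ S then 1 else 0

/-- The quadratic form `Q(n) = α₁ n₁² + α₂ n₂²`; the Laplacian of the torus with parameters `α` is
the Fourier multiplier with symbol `-4π² Q(n)`. -/
def torusQ (α : Fin 2 → ℝ) (n : Fin 2 → ℤ) : ℝ := ∑ j, α j * (n j : ℝ) ^ 2

/-- The linear Schrödinger evolution `e^{itΔ} f = ∑ₙ f̂(n) e^{2πi(n·x + Q(n)t)}`. -/
def schrodingerFlow (α : Fin 2 → ℝ) (t : ℝ) : L2Torus → L2Torus :=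
  fourierMultiplier fun n => Complex.exp (2 * Real.pi * Complex.I * (torusQ α n * t : ℝ))

/-- The collection `ℛ_{N,M}` of all `R ⊆ ℤ²` such that `O R + z ⊆ [-N,N] × [-M,M]` for some
orthogonal matrix `O` and some `z ∈ ℤ²`. -/
def rectSets (N M : ℝ) : Set (Set (Fin 2 → ℤ)) :=
  {R | ∃ O ∈ Matrix.orthogonalGroup (Fin 2) ℝ, ∃ z : Fin 2 → ℤ, ∀ n ∈ R,
    (O *ᵥ (fun j => (n j : ℝ))) 0 + (z 0 : ℝ) ∈ Set.Icc (-N) N ∧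
    (O *ᵥ (fun j => (n j : ℝ))) 1 + (z 1 : ℝ) ∈ Set.Icc (-M) M}

/-- The collection `𝒞_N = ℛ_{N,N}`. -/
def cubeSets (N : ℝ) : Set (Set (Fin 2 → ℤ)) := rectSets N N

/-- The mixed norm of `u` in `L^p(τ, L^q(𝕋²))`, with values in `[0, ∞]`. -/
def mixedNorm (p q : ℝ≥0∞) (τ : Set ℝ) (u : ℝ → L2Torus) : ℝ≥0∞ :=
  eLpNorm (fun t => eLpNorm (u t) q torusMeasure) p (volume.restrict τ)

end

/-! The core is a Strichartz estimate in `L^p_t L^6_x`, `p > 6`, with no loss in `N`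
(`exists_lintegral_trigWave_le`). It rests on the kernel of the propagator, cut off in frequency by
a Gaussian of width `N` about an arbitrary centre. As `Q` is diagonal, the kernel factors into two
one-dimensional Weyl sums. Weyl differencing followed by Poisson summation gives `|K_t(x)| ≤ N
(θ(α₁t) θ(α₂t))^{1/2}` uniformly in `x` and in the centre, with `θ = weylTheta N`.

If `θ(t) > l` with `l` large, then Dirichlet approximation places `2t` within `O(1/(q l N))` of a
fraction with denominator `q ≲ N / l` (`exists_approx_of_lt_weylTheta`). Such times have measure
`O(l⁻²)`, uniformly in `N`; since `θ ≲ N`, this gives `∫ θ^r ≲ N^{r-2}` for every `r > 2`. The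
argument treats each coordinate separately, so no arithmetic relation between `α₁` and `α₂` plays a
role.

Interpolating the bound `L¹ → L^∞` by `‖K_t‖_∞` with the contraction on `L²` gives `L^{6/5} → L⁶`
with norm `O(‖K_t‖_∞^{2/3})`. In the `TT*` argument, Young's inequality in time asks for the
`L^{p/2}` norm of this decay rate. By Cauchy–Schwarz this is a moment of `θ` of order `r = p/3`, and
`r > 2` is the condition `p > 6`. Duality then gives the estimate on `L⁶`.

For `q > 6`, a set in `rectSets N M` has `O(NM)` points, so the solution is bounded by
`O((NM)^{1/2})` times its `L²` norm. Hölder's inequality between this bound and the `L^{6p/q}_t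
L⁶_x` estimate gives finite `p`; for `p = ∞`, conservation of the `L²` norm replaces the latter. The
cube estimate is the case `q = 6`, `M = N`. -/

/-! ### Gaussian sums over translated lattices. -/

/-- The sum of the Gaussian `x ↦ exp (-a x²)` over the translated lattice `ℤ + θ`. -/
noncomputable def gaussTsum (a θ : ℝ) : ℝ≥0∞ :=
  ∑' k : ℤ, ENNReal.ofReal (Real.exp (-a * ((k : ℝ) + θ) ^ 2))

/-- The Gaussian decreases on the half-line, so each term is at most the integral over the unit
interval before it; together these make up at most half a Gaussian integral. -/
lemma sum_exp_neg_mul_sq_le {a : ℝ} (ha : 0 < a) (n : ℕ) :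
    ∑ i ∈ Finset.range n, Real.exp (-a * ((i : ℝ) + 1) ^ 2) ≤ Real.sqrt (Real.pi / a) / 2 := by
  have hanti : AntitoneOn (fun x : ℝ => Real.exp (-a * x ^ 2)) (Set.Icc 0 (0 + (n : ℝ))) := by
    intro x hx y hy hxy
    refine Real.exp_le_exp.2 ?_
    have : x ^ 2 ≤ y ^ 2 := pow_le_pow_left₀ hx.1 hxy 2
    nlinarith
  have h := hanti.sum_le_integral
  simp only [zero_add, Nat.cast_add, Nat.cast_one] at h
  refine h.trans ?_
  rw [← integral_gaussian_Ioi a, intervalIntegral.integral_of_le (Nat.cast_nonneg n)]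
  refine setIntegral_mono_set (integrable_exp_neg_mul_sq ha).integrableOn
    (Filter.Eventually.of_forall fun x => (Real.exp_pos _).le)
    (Set.Ioc_subset_Ioi_self).eventuallyLE

lemma tsum_exp_neg_mul_sq_le {a : ℝ} (ha : 0 < a) :
    ∑' n : ℕ, ENNReal.ofReal (Real.exp (-a * ((n : ℝ) + 1) ^ 2)) ≤
      ENNReal.ofReal (Real.sqrt (Real.pi / a) / 2) := by
  refine ENNReal.tsum_le_of_sum_range_le fun n => ?_
  rw [← ENNReal.ofReal_sum_of_nonneg fun i _ => (Real.exp_pos _).le]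
  exact ENNReal.ofReal_le_ofReal (sum_exp_neg_mul_sq_le ha n)

lemma gaussTsum_zero_le {a : ℝ} (ha : 0 < a) :
    gaussTsum a 0 ≤ ENNReal.ofReal (1 + Real.sqrt (Real.pi / a)) := by
  have h1 : HasSum (fun n : ℕ => ENNReal.ofReal (Real.exp (-a * (((n : ℤ) : ℝ) + 0) ^ 2)))
      (∑' n : ℕ, ENNReal.ofReal (Real.exp (-a * (((n : ℤ) : ℝ) + 0) ^ 2))) :=
    ENNReal.summable.hasSum
  have h2 : HasSum
      (fun n : ℕ => ENNReal.ofReal (Real.exp (-a * (((-(n + 1 : ℤ) : ℤ) : ℝ) + 0) ^ 2)))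
      (∑' n : ℕ, ENNReal.ofReal (Real.exp (-a * (((-(n + 1 : ℤ) : ℤ) : ℝ) + 0) ^ 2))) :=
    ENNReal.summable.hasSum
  have h := HasSum.of_nat_of_neg_add_one
    (f := fun k : ℤ => ENNReal.ofReal (Real.exp (-a * ((k : ℝ) + 0) ^ 2))) h1 h2
  rw [gaussTsum, h.tsum_eq, tsum_eq_zero_add' ENNReal.summable]
  have e1 : ∀ n : ℕ, -a * (((-(n + 1 : ℤ) : ℤ) : ℝ) + 0) ^ 2 = -a * ((n : ℝ) + 1) ^ 2 := by
    intro n; push_cast; ring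
  have e2 : ∀ n : ℕ, -a * ((((n + 1 : ℕ) : ℤ) : ℝ) + 0) ^ 2 = -a * ((n : ℝ) + 1) ^ 2 := by
    intro n; push_cast; ring
  simp only [e1, e2]
  have hs := tsum_exp_neg_mul_sq_le ha
  have h0 : ENNReal.ofReal (Real.exp (-a * ((((0 : ℕ) : ℤ) : ℝ) + 0) ^ 2)) = ENNReal.ofReal 1 := by
    simp
  rw [h0]
  refine (add_le_add (add_le_add le_rfl hs) hs).trans_eq ?_
  rw [← ENNReal.ofReal_add (by norm_num) (by positivity),
    ← ENNReal.ofReal_add (by positivity) (by positivity)]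
  congr 1; ring

/-- Of the endpoints of `[k, k + 1]`, the one nearer to the origin carries a value at least as large
as any inside. -/
lemma exp_neg_mul_add_sq_le {a ρ : ℝ} (ha : 0 < a) (h0 : 0 ≤ ρ) (h1 : ρ ≤ 1) (k : ℤ) :
    Real.exp (-a * ((k : ℝ) + ρ) ^ 2) ≤
      Real.exp (-a * (k : ℝ) ^ 2) + Real.exp (-a * ((k : ℝ) + 1) ^ 2) := by
  rcases le_or_gt 0 k with hk | hk
  · have hk' : (0 : ℝ) ≤ k := by exact_mod_cast hk
    have : Real.exp (-a * ((k : ℝ) + ρ) ^ 2) ≤ Real.exp (-a * (k : ℝ) ^ 2) :=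
      Real.exp_le_exp.2 (by
        have : (k : ℝ) ^ 2 ≤ ((k : ℝ) + ρ) ^ 2 := pow_le_pow_left₀ hk' (by linarith) 2
        nlinarith)
    linarith [Real.exp_pos (-a * ((k : ℝ) + 1) ^ 2)]
  · have hk' : (k : ℝ) + 1 ≤ 0 := by exact_mod_cast hk
    have hs : ((k : ℝ) + 1) ^ 2 ≤ ((k : ℝ) + ρ) ^ 2 := by nlinarith
    have : Real.exp (-a * ((k : ℝ) + ρ) ^ 2) ≤ Real.exp (-a * ((k : ℝ) + 1) ^ 2) :=
      Real.exp_le_exp.2 (by nlinarith)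
    linarith [Real.exp_pos (-a * (k : ℝ) ^ 2)]

lemma gaussTsum_add_int (a θ : ℝ) (m : ℤ) : gaussTsum a (θ + m) = gaussTsum a θ := by
  rw [gaussTsum, gaussTsum, ← (Equiv.addRight m).tsum_eq
    (fun k : ℤ => ENNReal.ofReal (Real.exp (-a * ((k : ℝ) + θ) ^ 2)))]
  refine tsum_congr fun k => ?_
  congr 3
  simp only [Equiv.coe_addRight, Int.cast_add]
  ring

/-- After reduction to a shift in `[0, 1)`, the sum is dominated by two unshifted ones, each at most
`1 + √(π/a) ≤ 1 + 2/√a`. Uniformity in `θ` is the point. -/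
lemma gaussTsum_le {a : ℝ} (ha : 0 < a) (θ : ℝ) :
    gaussTsum a θ ≤ ENNReal.ofReal (2 + 4 / Real.sqrt a) := by
  rw [← Int.fract_add_floor θ, gaussTsum_add_int]
  have h : gaussTsum a (Int.fract θ) ≤ gaussTsum a 0 + gaussTsum a ((0 : ℝ) + (1 : ℤ)) := by
    rw [gaussTsum, gaussTsum, gaussTsum, ← ENNReal.tsum_add]
    refine ENNReal.tsum_le_tsum fun k => ?_
    rw [← ENNReal.ofReal_add (Real.exp_pos _).le (Real.exp_pos _).le]
    refine ENNReal.ofReal_le_ofReal ?_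
    simpa using exp_neg_mul_add_sq_le ha (Int.fract_nonneg θ) (Int.fract_lt_one θ).le k
  rw [gaussTsum_add_int] at h
  refine h.trans ((add_le_add (gaussTsum_zero_le ha) (gaussTsum_zero_le ha)).trans ?_)
  rw [← ENNReal.ofReal_add (by positivity) (by positivity)]
  refine ENNReal.ofReal_le_ofReal ?_
  have : Real.sqrt (Real.pi / a) ≤ 2 / Real.sqrt a := by
    rw [Real.sqrt_div Real.pi_pos.le]
    gcongr
    rw [Real.sqrt_le_left (by norm_num)]
    linarith [Real.pi_le_four]
  have e : 4 / Real.sqrt a = 2 * (2 / Real.sqrt a) := by ring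
  rw [e]; linarith

/-! ### The theta sum: size, major arcs and moments. -/

/-- The Gaussian-weighted lattice sum that controls Weyl sums of length `N` at time `t`. -/
noncomputable def weylTheta (N t : ℝ) : ℝ≥0∞ :=
  ∑' u : ℤ, ENNReal.ofReal (Real.exp (-(Real.pi / 2 / N ^ 2) * (u : ℝ) ^ 2)) *
    gaussTsum (Real.pi / 2 * N ^ 2) (-(2 * t * u))

lemma measurable_gaussTsum {a : ℝ} : Measurable (gaussTsum a) := by
  unfold gaussTsum
  fun_prop

lemma measurable_weylTheta {N : ℝ} : Measurable (weylTheta N) := by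
  unfold weylTheta
  refine Measurable.tsum fun u => Measurable.const_mul ?_ _
  exact measurable_gaussTsum.comp (by fun_prop)

lemma four_div_sqrt_le {c x : ℝ} (hc : 1 ≤ c) (hx : 0 < x) :
    4 / Real.sqrt (c * x ^ 2) ≤ 4 / x := by
  gcongr
  rw [Real.le_sqrt hx.le (by positivity)]
  nlinarith [sq_nonneg x]

lemma one_le_pi_div_two : 1 ≤ Real.pi / 2 := by linarith [Real.two_le_pi]

/-- The trivial bound: each inner sum is at most `6` and the outer weights add up to at most `6 N`.
It caps the levels in the moment estimate. -/
lemma weylTheta_le {N : ℝ} (hN : 1 ≤ N) (t : ℝ) : weylTheta N t ≤ ENNReal.ofReal (36 * N) := by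
  have hN0 : 0 < N := by linarith
  have h1 : ∀ θ, gaussTsum (Real.pi / 2 * N ^ 2) θ ≤ ENNReal.ofReal 6 := fun θ => by
    refine (gaussTsum_le (by positivity) θ).trans (ENNReal.ofReal_le_ofReal ?_)
    have := four_div_sqrt_le one_le_pi_div_two hN0
    have : 4 / N ≤ 4 := by rw [div_le_iff₀ hN0]; linarith
    linarith
  have h2 : gaussTsum (Real.pi / 2 / N ^ 2) 0 ≤ ENNReal.ofReal (6 * N) := by
    refine (gaussTsum_le (by positivity) 0).trans (ENNReal.ofReal_le_ofReal ?_)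
    have := four_div_sqrt_le (x := 1 / N) one_le_pi_div_two (by positivity)
    rw [_root_.one_div_pow, mul_one_div] at this
    have e : 4 / (1 / N) = 4 * N := by field_simp
    linarith
  calc weylTheta N t
      ≤ ∑' u : ℤ, ENNReal.ofReal (Real.exp (-(Real.pi / 2 / N ^ 2) * (u : ℝ) ^ 2)) *
          ENNReal.ofReal 6 := ENNReal.tsum_le_tsum fun u => by gcongr; exact h1 _
    _ = gaussTsum (Real.pi / 2 / N ^ 2) 0 * ENNReal.ofReal 6 := by
        rw [ENNReal.tsum_mul_right, gaussTsum]; simp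
    _ ≤ ENNReal.ofReal (6 * N) * ENNReal.ofReal 6 := by gcongr
    _ = ENNReal.ofReal (36 * N) := by
        rw [← ENNReal.ofReal_mul (by positivity)]; congr 1; ring

/-- As `a` is coprime to `q`, the points `k + r a / q` with `0 ≤ r < q` are distinct elements of
`(1/q) ℤ`, so the `q` sums together are at most one Gaussian sum over this finer lattice. The drift
`r β` is at most the width `1 / N` of the Gaussian and costs only the factor `exp 2`. -/
lemma sum_gaussTsum_le {N β y : ℝ} (hN : 1 ≤ N) {q : ℕ} (hq : 0 < q) {a : ℤ}
    (hcop : IsCoprime a (q : ℤ)) (hβ : (q : ℝ) * |β| ≤ 1 / N) :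
    ∑ r : Fin q, gaussTsum (Real.pi / 2 * N ^ 2) (y + ((r : ℕ) : ℝ) * β + ((r : ℕ) : ℝ) * (a / q)) ≤
      ENNReal.ofReal (Real.exp 2 * (2 + 6 * (q / N))) := by
  have hN0 : 0 < N := by linarith
  have hq0 : (0 : ℝ) < q := by exact_mod_cast hq
  set c := Real.pi / 2 * N ^ 2 with hc
  have hcpos : 0 < c := by positivity
  set f : ℤ → ℝ≥0∞ := fun j =>
    ENNReal.ofReal (Real.exp 2 * Real.exp (-(c / 2 / q ^ 2) * ((j : ℝ) + q * y) ^ 2)) with hf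
  have hpt : ∀ (r : Fin q) (k : ℤ),
      ENNReal.ofReal (Real.exp (-c * ((k : ℝ) + (y + ((r : ℕ) : ℝ) * β + ((r : ℕ) : ℝ) * (a / q))) ^ 2)) ≤
        f ((r : ℕ) * a + q * k) := by
    intro r k
    rw [hf]
    refine ENNReal.ofReal_le_ofReal ?_
    rw [← Real.exp_add]
    refine Real.exp_le_exp.2 ?_
    push_cast
    set X : ℝ := (k : ℝ) + y + ((r : ℕ) : ℝ) * (a / q) with hX
    have e1 : (((r : ℕ) : ℝ) * a + q * k + q * y) = q * X := by rw [hX]; field_simp; ring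
    have e2 : (k : ℝ) + (y + ((r : ℕ) : ℝ) * β + ((r : ℕ) : ℝ) * (a / q)) = X + ((r : ℕ) : ℝ) * β := by
      rw [hX]; ring
    have hη : (((r : ℕ) : ℝ) * β) ^ 2 ≤ (1 / N) ^ 2 := by
      rw [sq_le_sq, abs_mul, Nat.abs_cast, abs_of_pos (by positivity : 0 < 1 / N)]
      refine le_trans ?_ hβ
      gcongr
      exact r.2.le
    rw [e1, e2]
    set η : ℝ := ((r : ℕ) : ℝ) * β
    -- Halving the exponent pays for the drift, which is why `f` carries `c / 2`.
    have h3 : X ^ 2 / 2 - η ^ 2 ≤ (X + η) ^ 2 := by nlinarith [sq_nonneg (X + 2 * η)]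
    have h4 : c * η ^ 2 ≤ 2 := by
      calc c * η ^ 2 ≤ c * (1 / N) ^ 2 := by gcongr
        _ = Real.pi / 2 := by rw [hc]; field_simp
        _ ≤ 2 := by linarith [Real.pi_le_four]
    have e3 : -(c / 2 / (q : ℝ) ^ 2) * ((q : ℝ) * X) ^ 2 = -(c * (X ^ 2 / 2)) := by field_simp
    rw [e3]
    nlinarith
  have hinj : Function.Injective fun p : Fin q × ℤ => ((p.1 : ℕ) : ℤ) * a + q * p.2 := by
    rintro ⟨r, k⟩ ⟨r', k'⟩ h
    simp only at h
    have hd : (q : ℤ) ∣ (((r : ℕ) : ℤ) - (r' : ℕ)) * a := ⟨k' - k, by linarith⟩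
    have hd' : (q : ℤ) ∣ ((r : ℕ) : ℤ) - (r' : ℕ) := hcop.symm.dvd_of_dvd_mul_right hd
    have hr : ((r : ℕ) : ℤ) - (r' : ℕ) = 0 := by
      refine Int.eq_zero_of_abs_lt_dvd hd' ?_
      have := r.2; have := r'.2
      rw [abs_lt]; constructor <;> omega
    have hr' : r = r' := Fin.ext (by omega)
    subst hr'
    have : (q : ℤ) * k = q * k' := by linarith
    have hk := mul_left_cancel₀ (by exact_mod_cast hq.ne') this
    rw [hk]
  calc ∑ r : Fin q, gaussTsum c (y + ((r : ℕ) : ℝ) * β + ((r : ℕ) : ℝ) * (a / q))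
      ≤ ∑ r : Fin q, ∑' k : ℤ, f ((r : ℕ) * a + q * k) :=
        Finset.sum_le_sum fun r _ => ENNReal.tsum_le_tsum fun k => hpt r k
    _ = ∑' p : Fin q × ℤ, f (((p.1 : ℕ) : ℤ) * a + q * p.2) := by
        rw [ENNReal.tsum_prod', tsum_fintype]
    _ ≤ ∑' j : ℤ, f j := ENNReal.tsum_comp_le_tsum_of_injective hinj f
    _ = ENNReal.ofReal (Real.exp 2) * gaussTsum (c / 2 / q ^ 2) (q * y) := by
        rw [gaussTsum, ← ENNReal.tsum_mul_left]
        refine tsum_congr fun j => ?_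
        rw [hf, ← ENNReal.ofReal_mul (Real.exp_pos _).le]
    _ ≤ ENNReal.ofReal (Real.exp 2) * ENNReal.ofReal (2 + 6 * (q / N)) := by
        gcongr
        refine (gaussTsum_le (by positivity) _).trans (ENNReal.ofReal_le_ofReal ?_)
        have h5 : 4 / Real.sqrt (c / 2 / (q : ℝ) ^ 2) ≤ 6 * (q / N) := by
          have : (2 / 3) * (N / q) ≤ Real.sqrt (c / 2 / (q : ℝ) ^ 2) := by
            rw [Real.le_sqrt (by positivity) (by positivity), hc]
            have : (Real.pi / 2 * N ^ 2 / 2 / (q : ℝ) ^ 2) = (Real.pi / 4) * (N / q) ^ 2 := by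
              field_simp; norm_num
            rw [this, mul_pow]
            gcongr
            linarith [Real.two_le_pi]
          calc 4 / Real.sqrt (c / 2 / (q : ℝ) ^ 2) ≤ 4 / ((2 / 3) * (N / q)) := by gcongr
            _ = 6 * (q / N) := by field_simp; norm_num
        linarith
    _ = _ := by rw [← ENNReal.ofReal_mul (Real.exp_pos _).le]

/-- Write `u = r + q b`. On each block of `q` consecutive `u` the weight is controlled by its values
at the two ends, and the remaining sum over residues is `sum_gaussTsum_le`. The weights of the
blocks add up to `O(1 + N / q)`. -/
lemma weylTheta_le_of_approx {N t : ℝ} (hN : 1 ≤ N) {q : ℕ} (hq : 0 < q) {a : ℤ}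
    (hcop : IsCoprime a (q : ℤ)) (hβ : |q * (2 * t) - a| ≤ 1 / N) :
    weylTheta N t ≤
      ENNReal.ofReal ((4 + 8 * (N / q)) * (Real.exp 2 * (2 + 6 * (q / N)))) := by
  have hN0 : 0 < N := by linarith
  have hq0 : (0 : ℝ) < q := by exact_mod_cast hq
  have : NeZero q := ⟨hq.ne'⟩
  set β : ℝ := 2 * t - a / q with hβd
  have hβ' : (q : ℝ) * |-β| ≤ 1 / N := by
    refine le_trans (le_of_eq ?_) hβ
    rw [abs_neg, ← abs_of_pos hq0, ← abs_mul, abs_of_pos hq0, hβd]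
    congr 1; field_simp
  set d := Real.pi / 2 / N ^ 2 with hd
  have hdpos : 0 < d := by positivity
  set E : ℤ → ℝ≥0∞ := fun b => ENNReal.ofReal (Real.exp (-(d * q ^ 2) * (b : ℝ) ^ 2)) with hE
  set B : ℝ≥0∞ := ENNReal.ofReal (Real.exp 2 * (2 + 6 * (q / N)))
  have hw : ∀ (b : ℤ) (r : Fin q), ENNReal.ofReal
      (Real.exp (-d * (((r : ℕ) + q * b : ℤ) : ℝ) ^ 2)) ≤ E b + E (b + 1) := by
    intro b r
    rw [hE, ← ENNReal.ofReal_add (Real.exp_pos _).le (Real.exp_pos _).le]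
    refine ENNReal.ofReal_le_ofReal ?_
    have := exp_neg_mul_add_sq_le (a := d * q ^ 2) (ρ := (r : ℕ) / q) (by positivity)
      (by positivity) (by rw [div_le_one hq0]; exact_mod_cast r.2.le) b
    push_cast
    refine le_trans (le_of_eq ?_) this
    congr 1
    field_simp
    ring
  have hg : ∀ (b : ℤ) (r : Fin q),
      gaussTsum (Real.pi / 2 * N ^ 2) (-(2 * t * (((r : ℕ) + q * b : ℤ) : ℝ))) =
      gaussTsum (Real.pi / 2 * N ^ 2)
        ((-((b : ℝ) * q * β)) + ((r : ℕ) : ℝ) * (-β) + ((r : ℕ) : ℝ) * (((-a : ℤ) : ℝ) / q)) := by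
    intro b r
    -- With `2 t = a / q + β`, the multiple `q b` of `a / q` is the integer `a b` and drops out.
    rw [← gaussTsum_add_int _ _ (b * a)]
    congr 1
    push_cast
    rw [hβd]
    field_simp
    ring
  have hEs : ∑' b : ℤ, (E b + E (b + 1)) ≤ ENNReal.ofReal (4 + 8 * (N / q)) := by
    have h0 : ∑' b : ℤ, E b = gaussTsum (d * q ^ 2) 0 := by simp [gaussTsum, hE]
    have h1 : ∑' b : ℤ, E (b + 1) = ∑' b : ℤ, E b := (Equiv.addRight (1 : ℤ)).tsum_eq E
    rw [ENNReal.tsum_add, h1, h0]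
    have h2 : gaussTsum (d * q ^ 2) 0 ≤ ENNReal.ofReal (2 + 4 * (N / q)) := by
      refine (gaussTsum_le (by positivity) 0).trans (ENNReal.ofReal_le_ofReal ?_)
      have h := four_div_sqrt_le (x := q / N) one_le_pi_div_two (by positivity)
      have e : d * (q : ℝ) ^ 2 = Real.pi / 2 * (q / N) ^ 2 := by rw [hd]; field_simp
      have e' : 4 / ((q : ℝ) / N) = 4 * (N / q) := by field_simp
      rw [e]; linarith
    refine (add_le_add h2 h2).trans_eq ?_
    rw [← ENNReal.ofReal_add (by positivity) (by positivity)]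
    congr 1; ring
  have hterm : ∀ b : ℤ, ∑ r : Fin q, ENNReal.ofReal
      (Real.exp (-d * (((r : ℕ) + q * b : ℤ) : ℝ) ^ 2)) *
        gaussTsum (Real.pi / 2 * N ^ 2) (-(2 * t * (((r : ℕ) + q * b : ℤ) : ℝ))) ≤
      (E b + E (b + 1)) * B := by
    intro b
    calc _ ≤ ∑ r : Fin q, (E b + E (b + 1)) * gaussTsum (Real.pi / 2 * N ^ 2)
            ((-((b : ℝ) * q * β)) + ((r : ℕ) : ℝ) * (-β) + ((r : ℕ) : ℝ) * (((-a : ℤ) : ℝ) / q)) :=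
          Finset.sum_le_sum fun r _ => by rw [hg b r]; gcongr; exact hw b r
      _ ≤ _ := by
          rw [← Finset.mul_sum]
          gcongr
          exact sum_gaussTsum_le hN hq hcop.neg_left hβ'
  calc weylTheta N t
      = ∑' b : ℤ, ∑ r : Fin q, ENNReal.ofReal
          (Real.exp (-d * (((r : ℕ) + q * b : ℤ) : ℝ) ^ 2)) *
            gaussTsum (Real.pi / 2 * N ^ 2) (-(2 * t * (((r : ℕ) + q * b : ℤ) : ℝ))) := by
        rw [weylTheta, ← (Int.divModEquiv q).symm.tsum_eq, ENNReal.tsum_prod']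
        refine tsum_congr fun b => ?_
        rw [tsum_fintype]
        refine Finset.sum_congr rfl fun r _ => ?_
        simp only [Int.divModEquiv_symm_apply]
        congr 5 <;> push_cast <;> ring
    _ ≤ ∑' b : ℤ, (E b + E (b + 1)) * B := ENNReal.tsum_le_tsum hterm
    _ = (∑' b : ℤ, (E b + E (b + 1))) * B := ENNReal.tsum_mul_right
    _ ≤ ENNReal.ofReal (4 + 8 * (N / q)) * B := by gcongr
    _ = ENNReal.ofReal ((4 + 8 * (N / q)) * (Real.exp 2 * (2 + 6 * (q / N)))) := by
        rw [← ENNReal.ofReal_mul (by positivity)]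

/-- Dirichlet's theorem at height `l N / 640` yields a reduced fraction whose denominator is at most
`l N / 640`. If the denominator also exceeded `640 N / l`, both `q / N` and `N / q` would be at most
`l / 640`, and `weylTheta_le_of_approx` would contradict the size of the sum. -/
lemma exists_approx_of_lt_weylTheta {N t l : ℝ} (hN : 1 ≤ N) (hl : 1000 ≤ l)
    (h : ENNReal.ofReal l < weylTheta N t) :
    ∃ (q : ℕ) (a : ℤ), 0 < q ∧ (q : ℝ) ≤ 640 * N / l ∧ |q * (2 * t) - a| ≤ 640 / (l * N) := by
  have hN0 : 0 < N := by linarith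
  have hl0 : 0 < l := by linarith
  have hx1 : 1 ≤ l * N / 640 := by
    rw [le_div_iff₀ (by norm_num)]; nlinarith
  have hn : 0 < ⌊l * N / 640⌋₊ := Nat.floor_pos.2 hx1
  obtain ⟨x, hx, hxq⟩ := Real.exists_rat_abs_sub_le_and_den_le (2 * t) hn
  have hq0 : (0 : ℝ) < x.den := by exact_mod_cast x.den_pos
  have hqle : (x.den : ℝ) ≤ l * N / 640 :=
    (Nat.cast_le.2 hxq).trans (Nat.floor_le (by linarith))
  have habs : |x.den * (2 * t) - x.num| ≤ 640 / (l * N) := by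
    have e : (x.den : ℝ) * (2 * t) - x.num = x.den * (2 * t - x) := by
      have : (x : ℝ) = x.num / x.den := by exact_mod_cast (Rat.num_div_den x).symm
      rw [this]; field_simp
    rw [e, abs_mul, abs_of_pos hq0]
    calc x.den * |2 * t - x| ≤ x.den * (1 / ((⌊l * N / 640⌋₊ + 1) * x.den)) := by gcongr
      _ = 1 / (⌊l * N / 640⌋₊ + 1) := by field_simp
      _ ≤ 1 / (l * N / 640) := by
        gcongr
        exact (Nat.lt_floor_add_one _).le
      _ = 640 / (l * N) := by field_simp
  refine ⟨x.den, x.num, x.den_pos, ?_, habs⟩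
  by_contra hcon
  rw [not_le] at hcon
  have hcop : IsCoprime x.num (x.den : ℤ) := by
    rw [Int.isCoprime_iff_gcd_eq_one]
    simpa [Int.gcd] using x.reduced
  have hb := weylTheta_le_of_approx hN x.den_pos hcop (habs.trans (by
    rw [div_le_div_iff₀ (by positivity) hN0]; nlinarith))
  refine absurd (h.trans_le hb) (not_lt.2 (ENNReal.ofReal_le_ofReal ?_))
  have h1 : (x.den : ℝ) / N ≤ l / 640 := by
    rw [div_le_div_iff₀ hN0 (by norm_num)]
    rw [le_div_iff₀ (by norm_num)] at hqle; linarith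
  have h2 : N / (x.den : ℝ) ≤ l / 640 := by
    rw [div_le_div_iff₀ hq0 (by norm_num)]
    rw [div_lt_iff₀ hl0] at hcon; linarith
  have h3 : N / (x.den : ℝ) * (x.den / N) = 1 := by field_simp
  have he : Real.exp 2 ≤ 8 := by
    have : Real.exp 2 = Real.exp 1 ^ 2 := by rw [← Real.exp_nat_mul]; norm_num
    rw [this]
    have := Real.exp_one_lt_d9
    have := Real.exp_pos 1
    nlinarith
  have hpos1 : 0 ≤ N / (x.den : ℝ) := by positivity
  have hpos2 : 0 ≤ (x.den : ℝ) / N := by positivity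
  -- The two ratios have product `1`, so the total is at most `448 + (192 + 128) l / 640 = 448 + l /
  -- 2`, hence at most `l` when `l ≥ 1000`. This is the source of `640`.
  calc (4 + 8 * (N / x.den)) * (Real.exp 2 * (2 + 6 * (x.den / N)))
      ≤ (4 + 8 * (N / x.den)) * (8 * (2 + 6 * (x.den / N))) := by gcongr
    _ = 8 * (56 + 24 * (x.den / N) + 16 * (N / x.den)) := by linear_combination 384 * h3
    _ ≤ l := by linarith

/-- For each `q` there are at most `3 K q` numerators, each allowing an interval of `t` of length at
most `C ε / q`. Summed over `q ≤ 640 N / l` with `ε = 640 / (l N)`, the powers of `N` cancel. -/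
lemma volume_weylTheta_gt_le {C α N l : ℝ} {K : ℕ} (hC : 0 < C) (hK : 2 * C + 1 ≤ K)
    (hα : 1 / C < α) (hα' : α < C) (hN : 1 ≤ N) (hl : 1000 ≤ l) :
    volume {t ∈ Set.Icc (-1 : ℝ) 1 | ENNReal.ofReal l < weylTheta N (α * t)} ≤
      ENNReal.ofReal (3 * K * C * 640 ^ 2 / l ^ 2) := by
  have hN0 : 0 < N := by linarith
  have hl0 : 0 < l := by linarith
  have hα0 : 0 < α := lt_trans (by positivity) hα
  have hK1 : (1 : ℝ) ≤ K := by linarith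
  set ε : ℝ := 640 / (l * N) with hε
  have hε0 : 0 < ε := by positivity
  have hε1 : ε ≤ 1 := by rw [hε, div_le_one (by positivity)]; nlinarith
  set Q := ⌊640 * N / l⌋₊
  have hsub : {t ∈ Set.Icc (-1 : ℝ) 1 | ENNReal.ofReal l < weylTheta N (α * t)} ⊆
      ⋃ q ∈ Finset.Icc 1 Q, ⋃ a ∈ Finset.Icc (-(K * q : ℤ)) (K * q),
        Set.Icc (((a : ℝ) - ε) / (2 * α * q)) ((a + ε) / (2 * α * q)) := by
    rintro t ⟨ht, hlt⟩
    obtain ⟨q, a, hq, hqle, ha⟩ := exists_approx_of_lt_weylTheta hN hl hlt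
    have hq0 : (0 : ℝ) < q := by exact_mod_cast hq
    have hq1 : (1 : ℝ) ≤ q := by exact_mod_cast hq
    rw [abs_le] at ha
    have hat1 : α * t ≤ C := by nlinarith [ht.2]
    have hat2 : -C ≤ α * t := by nlinarith [ht.1]
    have h1 : (q : ℝ) * (2 * (α * t)) ≤ q * (2 * C) := by gcongr
    have h2 : (q : ℝ) * (2 * (-C)) ≤ q * (2 * (α * t)) := by gcongr
    have h3 : (q : ℝ) * (2 * C + 1) ≤ q * K := by gcongr
    simp only [Set.mem_iUnion, Finset.mem_Icc, Set.mem_Icc, exists_prop]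
    refine ⟨q, ⟨hq, Nat.le_floor hqle⟩, a, ⟨?_, ?_⟩, ?_, ?_⟩
    · have : (-(K * q : ℤ) : ℝ) ≤ a := by push_cast; linarith
      exact_mod_cast this
    · have : (a : ℝ) ≤ (K * q : ℤ) := by push_cast; linarith
      exact_mod_cast this
    · rw [div_le_iff₀ (by positivity)]; linarith
    · rw [le_div_iff₀ (by positivity)]; linarith
  refine (measure_mono hsub).trans ((measure_biUnion_finset_le _ _).trans ?_)
  have hq : ∀ q ∈ Finset.Icc 1 Q, volume (⋃ a ∈ Finset.Icc (-(K * q : ℤ)) (K * q),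
      Set.Icc (((a : ℝ) - ε) / (2 * α * q)) ((a + ε) / (2 * α * q))) ≤
      ENNReal.ofReal (3 * K * C * ε) := by
    intro q hq
    have hq1 : 1 ≤ q := (Finset.mem_Icc.1 hq).1
    have hq1' : (1 : ℝ) ≤ q := by exact_mod_cast hq1
    have hq0 : (0 : ℝ) < q := by linarith
    refine (measure_biUnion_finset_le _ _).trans ?_
    have : ∀ a ∈ Finset.Icc (-(K * q : ℤ)) (K * q),
        volume (Set.Icc (((a : ℝ) - ε) / (2 * α * q)) ((a + ε) / (2 * α * q))) ≤
          ENNReal.ofReal (C * ε / q) := by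
      intro a _
      rw [Real.volume_Icc]
      refine ENNReal.ofReal_le_ofReal ?_
      have e : ((a : ℝ) + ε) / (2 * α * q) - (a - ε) / (2 * α * q) = (1 / α) * ε / q := by
        field_simp; ring
      rw [e]
      gcongr
      rw [div_le_iff₀ hα0]
      rw [div_lt_iff₀ hC] at hα
      linarith
    refine (Finset.sum_le_sum this).trans ?_
    rw [Finset.sum_const, Int.card_Icc, nsmul_eq_mul, ← ENNReal.ofReal_natCast,
      ← ENNReal.ofReal_mul (by positivity)]
    refine ENNReal.ofReal_le_ofReal ?_
    have e : (((K * q + 1 - -(K * q) : ℤ).toNat : ℕ) : ℝ) = 2 * (K * q) + 1 := by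
      have : (K * q + 1 - -(K * q) : ℤ).toNat = 2 * (K * q) + 1 := by
        zify
        have h0 : (0 : ℤ) ≤ K * q := by positivity
        rw [Int.toNat_of_nonneg (by linarith)]; ring
      rw [this]; push_cast; ring
    rw [e]
    have : (2 * ((K : ℝ) * q) + 1) ≤ 3 * (K * q) := by nlinarith
    calc (2 * ((K : ℝ) * q) + 1) * (C * ε / q) ≤ 3 * (K * q) * (C * ε / q) := by gcongr
      _ = 3 * K * C * ε := by field_simp
  refine (Finset.sum_le_sum hq).trans ?_
  rw [Finset.sum_const, Nat.card_Icc, nsmul_eq_mul, ← ENNReal.ofReal_natCast,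
    ← ENNReal.ofReal_mul (by positivity)]
  refine ENNReal.ofReal_le_ofReal ?_
  rw [Nat.add_sub_cancel]
  calc (Q : ℝ) * (3 * K * C * ε) ≤ (640 * N / l) * (3 * K * C * ε) := by
        gcongr; exact Nat.floor_le (by positivity)
    _ = 3 * K * C * 640 ^ 2 / l ^ 2 := by rw [hε]; field_simp

/-- The moment estimate for `weylTheta`, without loss in `N`. -/
lemma exists_lintegral_weylTheta_rpow_le {C : ℝ} (hC : 0 < C) {r : ℝ} (hr : 2 < r) :
    ∃ D : ℝ, 0 < D ∧ ∀ α N : ℝ, 1 / C < α → α < C → 1 ≤ N →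
      ∫⁻ t in Set.Icc (-1 : ℝ) 1, weylTheta N (α * t) ^ r ≤ ENNReal.ofReal (D * N ^ (r - 2)) := by
  obtain ⟨K, hK⟩ := exists_nat_ge (2 * C + 1)
  -- The first summand covers levels below `1000`, where the measure is bounded by the length `2` of
  -- the time interval.
  set B : ℝ := 2 * 1000 ^ 2 + 3 * K * C * 640 ^ 2 with hB
  refine ⟨r * (B * (36 ^ (r - 2) / (r - 2))), ?_, fun α N hα hα' hN => ?_⟩
  · have : 0 < r - 2 := by linarith
    positivity
  have hN0 : 0 < N := by linarith
  have hr0 : 0 < r - 2 := by linarith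
  have hfin : ∀ t, weylTheta N t ≠ ∞ := fun t =>
    ((weylTheta_le hN t).trans_lt ENNReal.ofReal_lt_top).ne
  have e0 : ∀ t, weylTheta N (α * t) ^ r =
      ENNReal.ofReal ((weylTheta N (α * t)).toReal ^ r) := fun t => by
    rw [ENNReal.toReal_rpow, ENNReal.ofReal_toReal]
    exact ENNReal.rpow_ne_top_of_nonneg (by linarith) (hfin _)
  have hmeas : Measurable fun t => (weylTheta N (α * t)).toReal :=
    (measurable_weylTheta.comp (measurable_const_mul α)).ennreal_toReal
  simp only [e0]
  rw [lintegral_rpow_eq_lintegral_meas_lt_mul _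
    (Filter.Eventually.of_forall fun t => ENNReal.toReal_nonneg) hmeas.aemeasurable (by linarith)]
  -- In the layer-cake formula the distribution function is at most `B / l ^ 2` and vanishes beyond
  -- `36 N`. The resulting `l ^ (r - 3)` is integrable at `0` because `r > 2`.
  have hpt : ∀ l ∈ Set.Ioi (0 : ℝ), (volume.restrict (Set.Icc (-1 : ℝ) 1))
      {t | l < (weylTheta N (α * t)).toReal} * ENNReal.ofReal (l ^ (r - 1)) ≤
      (Set.Ioc 0 (36 * N)).indicator (fun l => ENNReal.ofReal (B * l ^ (r - 3))) l := by
    intro l hl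
    have hl0 : 0 < l := hl
    have hpow : l ^ (r - 1) = l ^ 2 * l ^ (r - 3) := by
      rw [← Real.rpow_natCast, ← Real.rpow_add hl0]; congr 1; push_cast; ring
    have hset : {t | l < (weylTheta N (α * t)).toReal} =
        {t | ENNReal.ofReal l < weylTheta N (α * t)} := by
      ext t
      exact (ENNReal.ofReal_lt_iff_lt_toReal hl0.le (hfin _)).symm
    rw [Measure.restrict_apply (measurableSet_lt measurable_const hmeas), hset]
    by_cases h36 : l ≤ 36 * N
    · rw [Set.indicator_of_mem (show l ∈ Set.Ioc 0 (36 * N) from ⟨hl0, h36⟩)]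
      have hv : volume ({t | ENNReal.ofReal l < weylTheta N (α * t)} ∩ Set.Icc (-1 : ℝ) 1) ≤
          ENNReal.ofReal (B / l ^ 2) := by
        rcases le_or_gt 1000 l with h | h
        · have := volume_weylTheta_gt_le hC hK hα hα' hN h
          rw [Set.inter_comm]
          refine this.trans (ENNReal.ofReal_le_ofReal ?_)
          gcongr
          rw [hB]; linarith
        · refine (measure_mono Set.inter_subset_right).trans ?_
          rw [Real.volume_Icc]
          refine ENNReal.ofReal_le_ofReal ?_
          rw [le_div_iff₀ (by positivity)]
          have : l ^ 2 ≤ 1000 ^ 2 := pow_le_pow_left₀ hl0.le h.le 2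
          have : 0 ≤ 3 * (K : ℝ) * C * 640 ^ 2 := by positivity
          rw [hB]; linarith
      refine (mul_le_mul_left hv _).trans_eq ?_
      rw [← ENNReal.ofReal_mul (by positivity), hpow]
      congr 1
      field_simp
    · have hempty : {t | ENNReal.ofReal l < weylTheta N (α * t)} = ∅ := by
        ext t
        simp only [Set.mem_ofPred_eq, Set.mem_empty_iff_false, iff_false, not_lt]
        exact (weylTheta_le hN _).trans (ENNReal.ofReal_le_ofReal (not_le.1 h36).le)
      simp [hempty]
  have hint : ∫⁻ l in Set.Ioc 0 (36 * N), ENNReal.ofReal (B * l ^ (r - 3)) =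
      ENNReal.ofReal (B * ((36 * N) ^ (r - 2) / (r - 2))) := by
    have hi : IntervalIntegrable (fun l : ℝ => B * l ^ (r - 3)) volume 0 (36 * N) :=
      (intervalIntegral.intervalIntegrable_rpow' (by linarith)).const_mul B
    rw [← ofReal_integral_eq_lintegral_ofReal
      ((intervalIntegrable_iff_integrableOn_Ioc_of_le (by positivity)).1 hi)]
    · rw [← intervalIntegral.integral_of_le (by positivity), intervalIntegral.integral_const_mul,
        integral_rpow (Or.inl (by linarith))]
      have e : r - 3 + 1 = r - 2 := by ring
      rw [e, Real.zero_rpow hr0.ne', sub_zero]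
    · filter_upwards [ae_restrict_mem measurableSet_Ioc] with l hl
      have := hl.1
      positivity
  calc _ ≤ ENNReal.ofReal r * ∫⁻ l in Set.Ioi 0,
          (Set.Ioc 0 (36 * N)).indicator (fun l => ENNReal.ofReal (B * l ^ (r - 3))) l := by
        exact mul_le_mul' le_rfl (setLIntegral_mono' measurableSet_Ioi hpt)
    _ = ENNReal.ofReal r * ∫⁻ l in Set.Ioc 0 (36 * N), ENNReal.ofReal (B * l ^ (r - 3)) := by
        rw [setLIntegral_indicator measurableSet_Ioc,
          Set.inter_eq_left.2 Set.Ioc_subset_Ioi_self]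
    _ = ENNReal.ofReal (r * (B * (36 ^ (r - 2) / (r - 2))) * N ^ (r - 2)) := by
        rw [hint, ← ENNReal.ofReal_mul (by linarith), Real.mul_rpow (by norm_num) hN0.le]
        congr 1; ring

/-! ### Weyl differencing and Poisson summation. -/

/-- The terms of the Gaussian-smoothed Weyl sum. -/
noncomputable def weylTerm (N t y : ℝ) (m : ℤ) : ℂ :=
  Complex.exp (((-Real.pi / N ^ 2 * (m : ℝ) ^ 2 : ℝ) : ℂ) +
    ((2 * Real.pi * (t * (m : ℝ) ^ 2 + y * m) : ℝ) : ℂ) * Complex.I)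

lemma norm_weylTerm (N t y : ℝ) (m : ℤ) :
    ‖weylTerm N t y m‖ = Real.exp (-Real.pi / N ^ 2 * (m : ℝ) ^ 2) := by
  rw [weylTerm, Complex.norm_exp]
  congr 1
  simp only [Complex.add_re, Complex.ofReal_re, Complex.re_ofReal_mul, Complex.I_re, mul_zero,
    add_zero]

lemma summable_exp_neg_mul_sq {a : ℝ} (ha : 0 < a) (θ : ℝ) :
    Summable fun k : ℤ => Real.exp (-a * ((k : ℝ) + θ) ^ 2) := by
  have h := ENNReal.summable_toReal
    (((gaussTsum_le ha θ).trans_lt ENNReal.ofReal_lt_top).ne)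
  simpa only [ENNReal.toReal_ofReal (Real.exp_pos _).le] using h

lemma summable_norm_weylTerm {N : ℝ} (hN : 0 < N) (t y : ℝ) :
    Summable fun m => ‖weylTerm N t y m‖ := by
  simp only [norm_weylTerm]
  have := summable_exp_neg_mul_sq (a := Real.pi / N ^ 2) (by positivity) 0
  simpa only [add_zero, neg_div] using this

/-- Differencing: `(m + u)² - m²` is affine in `m`, so the product is a Gaussian in `m` with linear
phase `2 t u`; the shift `y` survives only in a factor independent of `m`. -/
lemma weylTerm_mul_conj {N : ℝ} (hN : 0 < N) (t y : ℝ) (u m : ℤ) :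
    weylTerm N t y (m + u) * (starRingEnd ℂ) (weylTerm N t y m) =
      weylTerm N t y u * Complex.exp (-Real.pi * ((2 / N ^ 2 : ℝ) : ℂ) * (m : ℂ) ^ 2 +
        2 * Real.pi * (((-(u / N ^ 2) : ℝ) : ℂ) + ((2 * t * u : ℝ) : ℂ) * Complex.I) * m) := by
  have hN' : (N : ℂ) ≠ 0 := by exact_mod_cast hN.ne'
  simp only [weylTerm]
  rw [← Complex.exp_conj, ← Complex.exp_add, ← Complex.exp_add]
  congr 1
  simp only [map_add, map_mul, Complex.conj_ofReal, Complex.conj_I]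
  push_cast
  field_simp
  ring

/-- Poisson summation turns the Gaussian of width about `N` into one of width about `1 / N`, which
detects the distance of `2 t u` to the integers. Completing the square produces a growing factor in
`u` that uses up half of the decay of `weylTerm N t y u`. -/
lemma enorm_tsum_weylTerm_mul_conj_le {N : ℝ} (hN : 0 < N) (t y : ℝ) (u : ℤ) :
    ‖∑' m : ℤ, weylTerm N t y (m + u) * (starRingEnd ℂ) (weylTerm N t y m)‖ₑ ≤
      ENNReal.ofReal N * (ENNReal.ofReal (Real.exp (-(Real.pi / 2 / N ^ 2) * (u : ℝ) ^ 2)) *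
        gaussTsum (Real.pi / 2 * N ^ 2) (-(2 * t * u))) := by
  have hN' : (N : ℂ) ≠ 0 := by exact_mod_cast hN.ne'
  simp only [weylTerm_mul_conj hN]
  rw [tsum_mul_left, Complex.tsum_exp_neg_quadratic (by rw [Complex.ofReal_re]; positivity)]
  set b : ℂ := ((-(u / N ^ 2) : ℝ) : ℂ) + ((2 * t * u : ℝ) : ℂ) * Complex.I with hb
  have hterm : ∀ n : ℤ, ‖Complex.exp (-Real.pi / ((2 / N ^ 2 : ℝ) : ℂ) *
      ((n : ℂ) + Complex.I * b) ^ 2)‖ =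
      Real.exp (Real.pi / 2 / N ^ 2 * (u : ℝ) ^ 2) *
        Real.exp (-(Real.pi / 2 * N ^ 2) * ((n : ℝ) + -(2 * t * u)) ^ 2) := by
    intro n
    rw [Complex.norm_exp, ← Real.exp_add]
    congr 1
    have e : -Real.pi / ((2 / N ^ 2 : ℝ) : ℂ) * ((n : ℂ) + Complex.I * b) ^ 2 =
        ((Real.pi / 2 / N ^ 2 * (u : ℝ) ^ 2 +
          -(Real.pi / 2 * N ^ 2) * ((n : ℝ) + -(2 * t * u)) ^ 2 : ℝ) : ℂ) +
        ((Real.pi * u * ((n : ℝ) - 2 * t * u) : ℝ) : ℂ) * Complex.I := by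
      have : (n : ℂ) + Complex.I * b = (((n : ℝ) - 2 * t * u : ℝ) : ℂ) -
          ((u / N ^ 2 : ℝ) : ℂ) * Complex.I := by
        rw [hb]; push_cast; linear_combination (2 * (t : ℂ) * u) * Complex.I_sq
      rw [this]
      push_cast
      field_simp
      linear_combination (-(u : ℂ) ^ 2) * Complex.I_sq
    rw [e]
    simp only [Complex.add_re, Complex.ofReal_re, Complex.re_ofReal_mul, Complex.I_re, mul_zero,
      add_zero]
  have hpow : ‖1 / (((2 / N ^ 2 : ℝ) : ℂ)) ^ (1 / 2 : ℂ)‖ ≤ N := by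
    rw [norm_div, norm_one, Complex.norm_cpow_eq_rpow_re_of_pos (by positivity)]
    have e : ((1 / 2 : ℂ)).re = 1 / 2 := by norm_num
    rw [e, ← Real.sqrt_eq_rpow]
    rw [div_le_iff₀ (by positivity), Real.sqrt_div (by norm_num), Real.sqrt_sq hN.le]
    rw [mul_div_cancel₀ _ hN.ne']
    exact Real.one_le_sqrt.2 (by norm_num)
  have hw : ‖weylTerm N t y u‖ * Real.exp (Real.pi / 2 / N ^ 2 * (u : ℝ) ^ 2) =
      Real.exp (-(Real.pi / 2 / N ^ 2) * (u : ℝ) ^ 2) := by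
    rw [norm_weylTerm, ← Real.exp_add]; congr 1; ring
  rw [enorm_mul, enorm_mul]
  calc _ ≤ ‖weylTerm N t y u‖ₑ * (ENNReal.ofReal N *
        (ENNReal.ofReal (Real.exp (Real.pi / 2 / N ^ 2 * (u : ℝ) ^ 2)) *
          gaussTsum (Real.pi / 2 * N ^ 2) (-(2 * t * u)))) := by
        gcongr
        · rw [← ofReal_norm]; exact ENNReal.ofReal_le_ofReal hpow
        · refine enorm_tsum_le_tsum_enorm.trans_eq ?_
          rw [gaussTsum, ← ENNReal.tsum_mul_left]
          refine tsum_congr fun n => ?_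
          rw [← ENNReal.ofReal_mul (Real.exp_pos _).le, ← hterm, ofReal_norm]
    _ = _ := by
        rw [← hw, ENNReal.ofReal_mul (norm_nonneg _), ofReal_norm]
        ring

/-- The square is a double sum, regrouped by the difference `u` of the two indices. -/
lemma enorm_tsum_sq_le_tsum_enorm_autocorrelation {s : ℤ → ℂ} (hs : Summable fun m => ‖s m‖) :
    ‖∑' m, s m‖ₑ ^ 2 ≤ ∑' u : ℤ, ‖∑' m : ℤ, s (m + u) * (starRingEnd ℂ) (s m)‖ₑ := by
  have hs' : Summable fun m => ‖(starRingEnd ℂ) (s m)‖ := by simpa only [RCLike.norm_conj] using hs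
  set F : ℤ × ℤ → ℂ := fun p => s p.1 * (starRingEnd ℂ) (s p.2) with hF
  have hprod : Summable F := (hs.mul_norm hs').of_norm
  set e : ℤ × ℤ ≃ ℤ × ℤ := (Equiv.prodComm ℤ ℤ).trans
    ((Equiv.prodShear (Equiv.refl ℤ) fun m => Equiv.addLeft m).trans (Equiv.prodComm ℤ ℤ)) with he
  have hFe : ∀ u m : ℤ, (F ∘ e) (u, m) = s (m + u) * (starRingEnd ℂ) (s m) := fun u m => rfl
  have hprod' : Summable (F ∘ e) := e.summable_iff.2 hprod
  have h1 : (∑' m, s m) * (starRingEnd ℂ) (∑' m, s m) =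
      ∑' u : ℤ, ∑' m : ℤ, s (m + u) * (starRingEnd ℂ) (s m) := by
    rw [Complex.conj_tsum, tsum_mul_tsum_of_summable_norm hs hs']
    simp only [← hFe]
    rw [← hprod'.tsum_prod]
    exact (e.tsum_eq F).symm
  have h2 : ‖∑' m, s m‖ₑ ^ 2 = ‖(∑' m, s m) * (starRingEnd ℂ) (∑' m, s m)‖ₑ := by
    rw [enorm_mul, sq, ← ofReal_norm ((starRingEnd ℂ) _), RCLike.norm_conj, ofReal_norm]
  rw [h2, h1]
  exact enorm_tsum_le_tsum_enorm

/-- **Weyl's inequality** for Gaussian-smoothed sums, uniform in the linear phase. -/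
lemma enorm_tsum_weylTerm_sq_le {N : ℝ} (hN : 0 < N) (t y : ℝ) :
    ‖∑' m, weylTerm N t y m‖ₑ ^ 2 ≤ ENNReal.ofReal N * weylTheta N t := by
  refine (enorm_tsum_sq_le_tsum_enorm_autocorrelation (summable_norm_weylTerm hN t y)).trans ?_
  rw [weylTheta, ← ENNReal.tsum_mul_left]
  exact ENNReal.tsum_le_tsum fun u => enorm_tsum_weylTerm_mul_conj_le hN t y u

/-! ### The kernel of the frequency-localised propagator. -/

/-- Gaussian frequency weight centred at `c`, at scale `N`. -/
noncomputable def gaussWeight (N : ℝ) (c n : Fin 2 → ℤ) : ℝ :=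
  Real.exp (-Real.pi / N ^ 2 * (((n 0 : ℝ) - c 0) ^ 2 + ((n 1 : ℝ) - c 1) ^ 2))

/-- The symbol of the frequency-localised Schrödinger propagator at time `τ`. -/
noncomputable def flowSymbol (N : ℝ) (c : Fin 2 → ℤ) (α : Fin 2 → ℝ) (τ : ℝ) (n : Fin 2 → ℤ) : ℂ :=
  gaussWeight N c n * Complex.exp (2 * Real.pi * Complex.I * (torusQ α n * τ : ℝ))

lemma gaussWeight_nonneg (N : ℝ) (c n : Fin 2 → ℤ) : 0 ≤ gaussWeight N c n := (Real.exp_pos _).le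

lemma gaussWeight_le_one (N : ℝ) (c n : Fin 2 → ℤ) : gaussWeight N c n ≤ 1 := by
  rw [gaussWeight, Real.exp_le_one_iff, neg_div, neg_mul, neg_nonpos]
  positivity

lemma norm_exp_two_pi_I (x : ℝ) : ‖Complex.exp (2 * Real.pi * Complex.I * (x : ℝ))‖ = 1 := by
  have e : 2 * Real.pi * Complex.I * (x : ℝ) = ((2 * Real.pi * x : ℝ) : ℂ) * Complex.I := by
    push_cast; ring
  rw [e, Complex.norm_exp_ofReal_mul_I]

lemma norm_flowSymbol (N : ℝ) (c : Fin 2 → ℤ) (α : Fin 2 → ℝ) (τ : ℝ) (n : Fin 2 → ℤ) :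
    ‖flowSymbol N c α τ n‖ = gaussWeight N c n := by
  rw [flowSymbol, norm_mul, norm_exp_two_pi_I, mul_one, Complex.norm_real, Real.norm_eq_abs,
    abs_of_nonneg (gaussWeight_nonneg N c n)]

lemma summable_gaussWeight {N : ℝ} (hN : 0 < N) (c : Fin 2 → ℤ) : Summable (gaussWeight N c) := by
  have h : ∀ j, Summable fun k : ℤ => Real.exp (-(Real.pi / N ^ 2) * ((k : ℝ) + (-c j)) ^ 2) :=
    fun j => summable_exp_neg_mul_sq (by positivity) _
  have h2 := (h 0).mul_of_nonneg (h 1) (fun _ => (Real.exp_pos _).le) fun _ => (Real.exp_pos _).le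
  rw [← (finTwoArrowEquiv ℤ).symm.summable_iff]
  refine h2.congr fun p => ?_
  rw [← Real.exp_add]
  simp only [Function.comp_apply, gaussWeight, finTwoArrowEquiv_symm_apply, cons_val_zero,
    cons_val_one]
  congr 1
  ring

/-- Galilean invariance: with `n = c + m`, the centre contributes a unimodular constant and a
translation by `2 α τ c` of the linear phase. Since Weyl's inequality is uniform in that phase, the
kernel bound does not depend on `c`. -/
lemma flowSymbol_mul_mFourier (N : ℝ) (c : Fin 2 → ℤ) (α : Fin 2 → ℝ) (τ : ℝ) (y : Fin 2 → ℝ)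
    (n : Fin 2 → ℤ) :
    flowSymbol N c α τ n * UnitAddTorus.mFourier n (fun j => (y j : UnitAddCircle)) =
      ∏ j, Complex.exp (2 * Real.pi * Complex.I *
        (α j * τ * (c j : ℝ) ^ 2 + y j * c j : ℝ)) *
          weylTerm N (α j * τ) (y j + 2 * (α j * τ) * c j) (n j - c j) := by
  simp only [flowSymbol, UnitAddTorus.mFourier, ContinuousMap.coe_mk, Fin.prod_univ_two,
    gaussWeight, torusQ, Fin.sum_univ_two, weylTerm, fourier_coe_apply, Complex.ofReal_exp]
  simp only [← Complex.exp_add]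
  congr 1
  push_cast
  ring

/-- The kernel of the frequency-localised Schrödinger propagator is bounded by theta sums. -/
lemma enorm_tsum_flowSymbol_mul_mFourier_le {N : ℝ} (hN : 0 < N) (c : Fin 2 → ℤ) (α : Fin 2 → ℝ)
    (τ : ℝ) (x : UnitAddTorus (Fin 2)) :
    ‖∑' n, flowSymbol N c α τ n * UnitAddTorus.mFourier n x‖ₑ ≤
      ENNReal.ofReal N * (weylTheta N (α 0 * τ) * weylTheta N (α 1 * τ)) ^ (1 / 2 : ℝ) := by
  have hx : ∀ j, ∃ y : ℝ, (y : UnitAddCircle) = x j := fun j => QuotientAddGroup.mk_surjective _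
  choose y hy using hx
  have hxy : x = fun j => (y j : UnitAddCircle) := funext fun j => (hy j).symm
  subst hxy
  simp only [flowSymbol_mul_mFourier]
  set f : Fin 2 → ℤ → ℂ := fun j m => Complex.exp (2 * Real.pi * Complex.I *
    (α j * τ * (c j : ℝ) ^ 2 + y j * c j : ℝ)) *
      weylTerm N (α j * τ) (y j + 2 * (α j * τ) * c j) (m - c j) with hf
  have hsum : ∀ j, Summable fun m => ‖f j m‖ := fun j => by
    simp only [hf, norm_mul, norm_exp_two_pi_I, one_mul]
    exact (Equiv.subRight (c j)).summable_iff.2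
      (summable_norm_weylTerm hN (α j * τ) (y j + 2 * (α j * τ) * c j))
  have hbound : ∀ j, ‖∑' m, f j m‖ₑ ^ 2 ≤ ENNReal.ofReal N * weylTheta N (α j * τ) := fun j => by
    have h1 : ∑' m, f j m = Complex.exp (2 * Real.pi * Complex.I *
        (α j * τ * (c j : ℝ) ^ 2 + y j * c j : ℝ)) *
          ∑' m, weylTerm N (α j * τ) (y j + 2 * (α j * τ) * c j) m := by
      rw [tsum_mul_left]
      exact congrArg _ ((Equiv.subRight (c j)).tsum_eq _)
    rw [h1, enorm_mul, ← ofReal_norm, norm_exp_two_pi_I, ENNReal.ofReal_one, one_mul]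
    exact enorm_tsum_weylTerm_sq_le hN _ _
  have hprod : ∑' n : Fin 2 → ℤ, ∏ j, f j (n j) = (∑' m, f 0 m) * ∑' m, f 1 m := by
    rw [tsum_mul_tsum_of_summable_norm (hsum 0) (hsum 1),
      ← (finTwoArrowEquiv ℤ).symm.tsum_eq]
    refine tsum_congr fun p => ?_
    simp [Fin.prod_univ_two]
  rw [hprod, enorm_mul]
  have hroot : ∀ a : ℝ≥0∞, (a ^ 2) ^ (1 / 2 : ℝ) = a := fun a => by
    rw [← ENNReal.rpow_natCast, ← ENNReal.rpow_mul]; norm_num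
  rw [← hroot (‖∑' m, f 0 m‖ₑ * ‖∑' m, f 1 m‖ₑ), mul_pow]
  calc _ ≤ ((ENNReal.ofReal N * weylTheta N (α 0 * τ)) *
        (ENNReal.ofReal N * weylTheta N (α 1 * τ))) ^ (1 / 2 : ℝ) :=
        ENNReal.rpow_le_rpow (mul_le_mul' (hbound 0) (hbound 1)) (by norm_num)
    _ = _ := by
        rw [mul_mul_mul_comm, ENNReal.mul_rpow_of_nonneg _ _ (by norm_num), ← sq, hroot]

/-! ### Real interpolation from `L^{6/5}` to `L⁶`. -/

section Interpolation

variable {X : Type*} [MeasurableSpace X] {μ : Measure X}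

/-- The level integral left after Fubini in the interpolation theorem, where `v = |f|^{1/5}`: it
runs over `0 < l ≤ B / v`. -/
lemma lintegral_Ioi_ite_mul_pow_three_le {B v : ℝ} (hB : 0 < B) (hv : 0 ≤ v) :
    ∫⁻ l in Set.Ioi (0 : ℝ), (if v * l ≤ B then ENNReal.ofReal (24 * l ^ 3 * v ^ 10) else 0) ≤
      ENNReal.ofReal (6 * B ^ 4 * v ^ 6) := by
  rcases hv.eq_or_lt with rfl | hv
  · simp
  have hpt : ∀ l ∈ Set.Ioi (0 : ℝ),
      (if v * l ≤ B then ENNReal.ofReal (24 * l ^ 3 * v ^ 10) else 0) =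
      (Set.Ioc 0 (B / v)).indicator (fun l => ENNReal.ofReal (24 * l ^ 3 * v ^ 10)) l := by
    intro l hl
    have : (v * l ≤ B) ↔ l ∈ Set.Ioc 0 (B / v) := by
      rw [Set.mem_Ioc, le_div_iff₀ hv, mul_comm]
      exact ⟨fun h => ⟨hl, h⟩, fun h => h.2⟩
    simp only [this, Set.indicator_apply]
  have hBv : 0 ≤ B / v := by positivity
  have hi : IntervalIntegrable (fun l : ℝ => 24 * l ^ 3 * v ^ 10) volume 0 (B / v) :=
    Continuous.intervalIntegrable (by fun_prop) _ _
  rw [setLIntegral_congr_fun measurableSet_Ioi hpt, setLIntegral_indicator measurableSet_Ioc,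
    Set.inter_eq_left.2 Set.Ioc_subset_Ioi_self, ← ofReal_integral_eq_lintegral_ofReal
      ((intervalIntegrable_iff_integrableOn_Ioc_of_le hBv).1 hi)]
  · refine ENNReal.ofReal_le_ofReal (le_of_eq ?_)
    rw [← intervalIntegral.integral_of_le hBv, intervalIntegral.integral_mul_const,
      intervalIntegral.integral_const_mul, integral_pow]
    simp only [div_pow, Nat.cast_ofNat]
    field_simp
    ring
  · filter_upwards [ae_restrict_mem measurableSet_Ioc] with l hl
    have := hl.1
    simp only [Pi.zero_apply]
    positivity

/-- A case of the Marcinkiewicz interpolation theorem: an additive operator bounded from `L¹` to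
`L^∞` with norm `A` and contractive on `L²` maps `L^{6/5}` to `L⁶` with norm `O(A^{2/3})`. -/
theorem lintegral_enorm_rpow_six_le_of_interpolation [IsFiniteMeasure μ] {A : ℝ} (hA : 0 < A)
    {T : (X → ℂ) → X → ℂ}
    (hadd : ∀ f g, MemLp f 2 μ → MemLp g 2 μ → ∀ x, T (f + g) x = T f x + T g x)
    (hone : ∀ f, MemLp f 2 μ → ∀ x, ‖T f x‖ₑ ≤ ENNReal.ofReal A * ∫⁻ y, ‖f y‖ₑ ∂μ)
    (htwo : ∀ f, MemLp f 2 μ → ∫⁻ x, ‖T f x‖ₑ ^ 2 ∂μ ≤ ∫⁻ x, ‖f x‖ₑ ^ 2 ∂μ)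
    (hmeas : ∀ f, MemLp f 2 μ → Measurable (T f))
    {f : X → ℂ} (hfm : Measurable f) (hf : MemLp f 2 μ) :
    ∫⁻ x, ‖T f x‖ₑ ^ (6 : ℝ) ∂μ ≤
      ENNReal.ofReal (96 * A ^ 4) * (∫⁻ x, ‖f x‖ₑ ^ (6 / 5 : ℝ) ∂μ) ^ 5 := by
  -- With this root, `|f| = v⁵` and `|f|^{6/5} = v⁶`, so that only integer powers occur.
  set v : X → ℝ := fun x => ‖f x‖ ^ (1 / 5 : ℝ) with hvdef
  have hv0 : ∀ x, 0 ≤ v x := fun x => by positivity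
  have hv5 : ∀ x, ‖f x‖ = v x ^ 5 := fun x => by
    rw [hvdef, ← Real.rpow_natCast, ← Real.rpow_mul (norm_nonneg _)]; norm_num
  have hvm : Measurable v := hfm.norm.pow_const _
  have hv6 : ∀ x, ‖f x‖ₑ ^ (6 / 5 : ℝ) = ENNReal.ofReal (v x ^ 6) := fun x => by
    rw [← ofReal_norm, ENNReal.ofReal_rpow_of_nonneg (norm_nonneg _) (by norm_num)]
    congr 1
    rw [hvdef, ← Real.rpow_natCast, ← Real.rpow_mul (norm_nonneg _)]
    norm_num
  have hfe : ∀ x, ‖f x‖ₑ = ENNReal.ofReal (v x ^ 5) := fun x => by rw [← ofReal_norm, hv5]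
  set J' : ℝ≥0∞ := ∫⁻ x, ENNReal.ofReal (v x ^ 6) ∂μ with hJ'
  simp only [hv6]
  have hJfin : J' ≠ ∞ := by
    have h2 : ∫⁻ x, ‖f x‖ₑ ^ 2 ∂μ < ∞ := by
      have := hf.eLpNorm_lt_top
      rw [eLpNorm_lt_top_iff_lintegral_rpow_enorm_lt_top (by norm_num) (by norm_num)] at this
      simpa using this
    refine ((lintegral_mono fun x => ?_).trans_lt
      (?_ : ∫⁻ x, (1 + ‖f x‖ₑ ^ 2) ∂μ < ∞)).ne
    · rw [hfe, ← ENNReal.ofReal_pow (by have := hv0 x; positivity), ← ENNReal.ofReal_one,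
        ← ENNReal.ofReal_add (by norm_num) (by have := hv0 x; positivity)]
      refine ENNReal.ofReal_le_ofReal ?_
      have := hv0 x
      rcases le_total (v x) 1 with h | h
      · have : v x ^ 6 ≤ 1 := pow_le_one₀ (hv0 x) h
        have : 0 ≤ (v x ^ 5) ^ 2 := by positivity
        linarith
      · have : v x ^ 6 ≤ v x ^ 10 := pow_le_pow_right₀ h (by norm_num)
        have h10 : (v x ^ 5) ^ 2 = v x ^ 10 := by ring
        linarith
    · rw [lintegral_add_left measurable_const]
      exact ENNReal.add_lt_top.2 ⟨by simp, h2⟩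
  rcases eq_or_ne J' 0 with hJ0 | hJ0
  · have hz : ∀ᵐ x ∂μ, ENNReal.ofReal (v x ^ 6) = 0 :=
      (lintegral_eq_zero_iff ((hvm.pow_const 6).ennreal_ofReal)).1 hJ0
    have hz1 : ∫⁻ y, ‖f y‖ₑ ∂μ = 0 := by
      rw [lintegral_eq_zero_iff hfm.enorm]
      filter_upwards [hz] with x hx
      rw [ENNReal.ofReal_eq_zero] at hx
      have hvx : v x = 0 := by
        by_contra hne
        have := pow_pos (lt_of_le_of_ne (hv0 x) (Ne.symm hne)) 6
        linarith
      rw [hfe, hvx]; simp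
    have : ∀ x, ‖T f x‖ₑ = 0 := fun x => by
      have := hone f hf x
      rw [hz1, mul_zero] at this
      exact le_antisymm this bot_le
    simp [this]
  set J := J'.toReal with hJ
  have hJpos : 0 < J := ENNReal.toReal_pos hJ0 hJfin
  have hJJ : J' = ENNReal.ofReal J := (ENNReal.ofReal_toReal hJfin).symm
  -- At level `l`, cut `f` where `v = B / l`. The large part `b` has `L¹` norm at most `(l / B) ∫ v⁶
  -- = l J / B`, so this `B` makes `|T b| ≤ l / 2`; the small part is left to Chebyshev and the `L²`
  -- bound.
  set B := 2 * A * J with hB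
  have hBpos : 0 < B := by positivity
  have hlevel : ∀ l ∈ Set.Ioi (0 : ℝ), μ {x | l < ‖T f x‖} * ENNReal.ofReal (6 * l ^ (5 : ℝ)) ≤
      ∫⁻ x, (if v x * l ≤ B then ENNReal.ofReal (24 * l ^ 3 * v x ^ 10) else 0) ∂μ := by
    intro l hl
    have hl0 : 0 < l := hl
    set S : Set X := {x | v x * l ≤ B} with hS
    have hSm : MeasurableSet S := measurableSet_le (hvm.mul_const l) measurable_const
    set g := S.indicator f with hg
    set b := Sᶜ.indicator f with hb
    have hgL : MemLp g 2 μ := hf.indicator hSm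
    have hbL : MemLp b 2 μ := hf.indicator hSm.compl
    have hsum : b + g = f := by rw [add_comm]; exact Set.indicator_self_add_compl S f
    have hb1 : ∫⁻ y, ‖b y‖ₑ ∂μ ≤ ENNReal.ofReal (l / B) * J' := by
      rw [hJ', ← lintegral_const_mul _ ((hvm.pow_const 6).ennreal_ofReal)]
      refine lintegral_mono fun y => ?_
      by_cases hy : y ∈ S
      · simp [hb, hy]
      · rw [hb, Set.indicator_of_mem (show y ∈ Sᶜ from hy), hfe,
          ← ENNReal.ofReal_mul (by positivity)]
        refine ENNReal.ofReal_le_ofReal ?_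
        have hy' : B < v y * l := not_le.1 hy
        have h5 : 0 ≤ v y ^ 5 := pow_nonneg (hv0 y) 5
        rw [div_mul_eq_mul_div, le_div_iff₀ hBpos]
        nlinarith
    have hTb : ∀ x, ‖T b x‖ ≤ l / 2 := fun x => by
      have h := (hone b hbL x).trans (mul_le_mul' le_rfl hb1)
      rw [hJJ, ← ENNReal.ofReal_mul (by positivity), ← ENNReal.ofReal_mul hA.le,
        ← ofReal_norm, ENNReal.ofReal_le_ofReal_iff (by positivity)] at h
      refine h.trans (le_of_eq ?_)
      rw [hB]; field_simp
    have hsub : {x | l < ‖T f x‖} ⊆ {x | ENNReal.ofReal ((l / 2) ^ 2) ≤ ‖T g x‖ₑ ^ 2} := by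
      intro x hx
      have hx' : l < ‖T f x‖ := hx
      have h1 : T f x = T b x + T g x := by rw [← hadd b g hbL hgL x, hsum]
      have h2 : l / 2 ≤ ‖T g x‖ := by
        have := norm_add_le (T b x) (T g x)
        rw [← h1] at this
        linarith [hTb x]
      change ENNReal.ofReal ((l / 2) ^ 2) ≤ ‖T g x‖ₑ ^ 2
      rw [← ofReal_norm, ← ENNReal.ofReal_pow (norm_nonneg _)]
      exact ENNReal.ofReal_le_ofReal (pow_le_pow_left₀ (by positivity) h2 2)
    have hcheb := (mul_meas_ge_le_lintegral ((hmeas g hgL).enorm.pow_const 2)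
      (ENNReal.ofReal ((l / 2) ^ 2)) (μ := μ)).trans (htwo g hgL)
    have hgsq : ∀ x, ENNReal.ofReal (24 * l ^ 3) * ‖g x‖ₑ ^ 2 =
        if v x * l ≤ B then ENNReal.ofReal (24 * l ^ 3 * v x ^ 10) else 0 := by
      intro x
      by_cases hx : v x * l ≤ B
      · rw [if_pos hx, hg, Set.indicator_of_mem (show x ∈ S from hx), hfe,
          ← ENNReal.ofReal_pow (pow_nonneg (hv0 x) 5), ← ENNReal.ofReal_mul (by positivity),
          ← pow_mul]
      · rw [if_neg hx, hg, Set.indicator_of_notMem (show x ∉ S from hx)]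
        simp
    have hgm : Measurable fun x => ‖g x‖ₑ ^ 2 := (hfm.indicator hSm).enorm.pow_const 2
    calc μ {x | l < ‖T f x‖} * ENNReal.ofReal (6 * l ^ (5 : ℝ))
        ≤ μ {x | ENNReal.ofReal ((l / 2) ^ 2) ≤ ‖T g x‖ₑ ^ 2} *
            ENNReal.ofReal (6 * l ^ (5 : ℝ)) := mul_le_mul' (measure_mono hsub) le_rfl
      _ = ENNReal.ofReal (24 * l ^ 3) * (ENNReal.ofReal ((l / 2) ^ 2) *
            μ {x | ENNReal.ofReal ((l / 2) ^ 2) ≤ ‖T g x‖ₑ ^ 2}) := by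
          rw [← mul_assoc, ← ENNReal.ofReal_mul (by positivity), mul_comm]
          congr 2
          have : l ^ (5 : ℝ) = l ^ 5 := by rw [← Real.rpow_natCast]; norm_num
          rw [this]; ring
      _ ≤ ENNReal.ofReal (24 * l ^ 3) * ∫⁻ x, ‖g x‖ₑ ^ 2 ∂μ := mul_le_mul' le_rfl hcheb
      _ = _ := by
          rw [← lintegral_const_mul _ hgm]
          exact lintegral_congr hgsq
  have hTm := hmeas f hf
  have hlayer : ∫⁻ x, ‖T f x‖ₑ ^ (6 : ℝ) ∂μ =
      ∫⁻ l in Set.Ioi (0 : ℝ), μ {x | l < ‖T f x‖} * ENNReal.ofReal (6 * l ^ (5 : ℝ)) := by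
    have e : ∀ x, ‖T f x‖ₑ ^ (6 : ℝ) = ENNReal.ofReal (‖T f x‖ ^ (6 : ℝ)) := fun x => by
      rw [← ofReal_norm, ENNReal.ofReal_rpow_of_nonneg (norm_nonneg _) (by norm_num)]
    simp only [e]
    rw [lintegral_rpow_eq_lintegral_meas_lt_mul μ (Filter.Eventually.of_forall fun x =>
      norm_nonneg _) hTm.norm.aemeasurable (by norm_num), ← lintegral_const_mul' _ _ (by simp)]
    refine lintegral_congr fun l => ?_
    rw [ENNReal.ofReal_mul (by norm_num)]
    norm_num
    ring
  rw [hlayer]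
  calc _ ≤ ∫⁻ l in Set.Ioi (0 : ℝ), ∫⁻ x,
          (if v x * l ≤ B then ENNReal.ofReal (24 * l ^ 3 * v x ^ 10) else 0) ∂μ :=
        setLIntegral_mono' measurableSet_Ioi hlevel
    _ = ∫⁻ x, (∫⁻ l in Set.Ioi (0 : ℝ),
          (if v x * l ≤ B then ENNReal.ofReal (24 * l ^ 3 * v x ^ 10) else 0)) ∂μ := by
        refine lintegral_lintegral_swap (Measurable.aemeasurable ?_)
        refine Measurable.ite (measurableSet_le ?_ measurable_const) ?_ measurable_const
        · exact (hvm.comp measurable_snd).mul measurable_fst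
        · exact ((measurable_const.mul (measurable_fst.pow_const 3)).mul
            ((hvm.comp measurable_snd).pow_const 10)).ennreal_ofReal
    _ ≤ ∫⁻ x, ENNReal.ofReal (6 * B ^ 4) * ENNReal.ofReal (v x ^ 6) ∂μ := by
        refine lintegral_mono fun x => ?_
        rw [← ENNReal.ofReal_mul (by positivity)]
        exact lintegral_Ioi_ite_mul_pow_three_le hBpos (hv0 x)
    _ = ENNReal.ofReal (96 * A ^ 4) * J' ^ 5 := by
        rw [lintegral_const_mul _ ((hvm.pow_const 6).ennreal_ofReal), ← hJ', hJJ,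
          ← ENNReal.ofReal_pow hJpos.le, ← ENNReal.ofReal_mul (by positivity),
          ← ENNReal.ofReal_mul (by positivity), hB]
        congr 1; ring

end Interpolation

/-! ### Fourier multipliers with summable symbol on the torus. -/

open UnitAddTorus in
lemma mFourierCoeff_eq_integral_torusMeasure (f : UnitAddTorus (Fin 2) → ℂ) (n : Fin 2 → ℤ) :
    mFourierCoeff f n = ∫ x, mFourier (-n) x * f x ∂torusMeasure := rfl

open UnitAddTorus in
lemma mFourierCoeff_congr_ae {f g : UnitAddTorus (Fin 2) → ℂ} (h : f =ᵐ[torusMeasure] g)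
    (n : Fin 2 → ℤ) : mFourierCoeff f n = mFourierCoeff g n := by
  rw [mFourierCoeff_eq_integral_torusMeasure, mFourierCoeff_eq_integral_torusMeasure]
  refine integral_congr_ae ?_
  filter_upwards [h] with x hx
  rw [hx]

namespace UnitAddTorus

lemma norm_mFourier_apply (n : Fin 2 → ℤ) (x : UnitAddTorus (Fin 2)) : ‖mFourier n x‖ = 1 := by
  simp only [mFourier, ContinuousMap.coe_mk, fourier_apply, norm_prod, Circle.norm_coe,
    Finset.prod_const_one]

lemma mFourier_sub_apply (n : Fin 2 → ℤ) (x y : UnitAddTorus (Fin 2)) :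
    mFourier n (x - y) = mFourier n x * mFourier (-n) y := by
  simp only [mFourier, ContinuousMap.coe_mk, ← Finset.prod_mul_distrib]
  refine Finset.prod_congr rfl fun j _ => ?_
  simp only [fourier_apply, Pi.neg_apply, Pi.sub_apply, neg_smul, sub_eq_add_neg, smul_add,
    smul_neg, AddCircle.toCircle_add, Circle.coe_mul]

lemma integrable_mFourier_mul {f : UnitAddTorus (Fin 2) → ℂ} (hf : Integrable f torusMeasure)
    (n : Fin 2 → ℤ) : Integrable (fun x => mFourier n x * f x) torusMeasure :=
  hf.bdd_mul (c := 1) (mFourier n).continuous.aestronglyMeasurable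
    (Filter.Eventually.of_forall fun x => (norm_mFourier_apply n x).le)

lemma norm_mFourierCoeff_le {f : UnitAddTorus (Fin 2) → ℂ} (n : Fin 2 → ℤ) :
    ‖mFourierCoeff f n‖ ≤ ∫ x, ‖f x‖ ∂torusMeasure := by
  rw [mFourierCoeff_eq_integral_torusMeasure]
  refine (norm_integral_le_integral_norm _).trans_eq ?_
  simp [norm_mFourier_apply]

lemma mFourierCoeff_add {f g : UnitAddTorus (Fin 2) → ℂ} (hf : Integrable f torusMeasure)
    (hg : Integrable g torusMeasure) (n : Fin 2 → ℤ) :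
    mFourierCoeff (f + g) n = mFourierCoeff f n + mFourierCoeff g n := by
  simp only [mFourierCoeff_eq_integral_torusMeasure, Pi.add_apply, mul_add]
  exact integral_add (integrable_mFourier_mul hf _) (integrable_mFourier_mul hg _)

/-- **Parseval's identity** for square-integrable functions on the two-dimensional torus. -/
lemma lintegral_enorm_sq_eq_tsum {f : UnitAddTorus (Fin 2) → ℂ} (hf : MemLp f 2 torusMeasure) :
    ∫⁻ x, ‖f x‖ₑ ^ 2 ∂torusMeasure = ∑' n, ‖mFourierCoeff f n‖ₑ ^ 2 := by
  have h := hasSum_sq_mFourierCoeff (hf.toLp f)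
  have hc : ∀ n, mFourierCoeff (hf.toLp f) n = mFourierCoeff f n :=
    fun n => mFourierCoeff_congr_ae hf.coeFn_toLp n
  simp only [hc] at h
  have hi : ∫ x, ‖(hf.toLp f) x‖ ^ 2 ∂torusMeasure = ∫ x, ‖f x‖ ^ 2 ∂torusMeasure := by
    refine integral_congr_ae ?_
    filter_upwards [hf.coeFn_toLp] with x hx
    rw [hx]
  have e1 : ∀ z : ℂ, ‖z‖ₑ ^ 2 = ENNReal.ofReal (‖z‖ ^ 2) := fun z => by
    rw [← ofReal_norm, ENNReal.ofReal_pow (norm_nonneg _)]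
  simp only [e1]
  rw [← ENNReal.ofReal_tsum_of_nonneg (fun n => by positivity) h.summable, h.tsum_eq,
    ← ofReal_integral_eq_lintegral_ofReal hf.integrable_norm_pow'
      (Filter.Eventually.of_forall fun x => by positivity)]
  exact congrArg _ hi.symm

/-- The Fourier multiplier with an absolutely summable symbol, as a continuous function. -/
noncomputable def smoothMultiplier (m : (Fin 2 → ℤ) → ℂ) (f : UnitAddTorus (Fin 2) → ℂ) :
    C(UnitAddTorus (Fin 2), ℂ) :=
  ∑' n, (m n * mFourierCoeff f n) • mFourier n

section SmoothMultiplier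

variable {m : (Fin 2 → ℤ) → ℂ} {f g : UnitAddTorus (Fin 2) → ℂ}

lemma summable_norm_mul_mFourierCoeff (hm : Summable fun n => ‖m n‖)
    (f : UnitAddTorus (Fin 2) → ℂ) : Summable fun n => ‖m n * mFourierCoeff f n‖ := by
  refine Summable.of_nonneg_of_le (fun _ => norm_nonneg _) (fun n => ?_)
    (hm.mul_right (∫ x, ‖f x‖ ∂torusMeasure))
  rw [norm_mul]
  exact mul_le_mul_of_nonneg_left (norm_mFourierCoeff_le n) (norm_nonneg _)

lemma hasSum_smoothMultiplier (hm : Summable fun n => ‖m n‖) (f : UnitAddTorus (Fin 2) → ℂ) :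
    HasSum (fun n => (m n * mFourierCoeff f n) • mFourier n) (smoothMultiplier m f) := by
  refine Summable.hasSum (Summable.of_norm ?_)
  simpa only [norm_smul, mFourier_norm, mul_one] using summable_norm_mul_mFourierCoeff hm f

lemma hasSum_smoothMultiplier_apply (hm : Summable fun n => ‖m n‖)
    (f : UnitAddTorus (Fin 2) → ℂ) (x : UnitAddTorus (Fin 2)) :
    HasSum (fun n => m n * mFourierCoeff f n * mFourier n x) (smoothMultiplier m f x) :=
  (hasSum_smoothMultiplier hm f).mapL (ContinuousMap.evalCLM ℂ x)

lemma smoothMultiplier_add (hm : Summable fun n => ‖m n‖) (hf : Integrable f torusMeasure)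
    (hg : Integrable g torusMeasure) (x : UnitAddTorus (Fin 2)) :
    smoothMultiplier m (f + g) x = smoothMultiplier m f x + smoothMultiplier m g x := by
  refine (hasSum_smoothMultiplier_apply hm (f + g) x).unique ?_
  refine ((hasSum_smoothMultiplier_apply hm f x).add (hasSum_smoothMultiplier_apply hm g x)).congr_fun
    fun n => ?_
  rw [mFourierCoeff_add hf hg]
  ring

lemma mFourierCoeff_smoothMultiplier (hm : Summable fun n => ‖m n‖)
    (f : UnitAddTorus (Fin 2) → ℂ) (k : Fin 2 → ℤ) :
    mFourierCoeff (smoothMultiplier m f) k = m k * mFourierCoeff f k := by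
  have h1 := (hasSum_smoothMultiplier hm f).mapL (ContinuousMap.toLp (E := ℂ) 2 torusMeasure ℂ)
  have h2 := h1.mapL (innerSL ℂ (mFourierLp 2 k : L2Torus))
  have h3 : HasSum (fun n => innerSL ℂ (mFourierLp 2 k : L2Torus)
      (ContinuousMap.toLp (E := ℂ) 2 torusMeasure ℂ ((m n * mFourierCoeff f n) • mFourier n)))
      (m k * mFourierCoeff f k) := by
    have ho := orthonormal_iff_ite.1 (orthonormal_mFourier (d := Fin 2))
    have e : ∀ n, innerSL ℂ (mFourierLp 2 k : L2Torus)
        (ContinuousMap.toLp (E := ℂ) 2 torusMeasure ℂ ((m n * mFourierCoeff f n) • mFourier n)) =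
        if n = k then m k * mFourierCoeff f k else 0 := by
      intro n
      rw [map_smul, innerSL_apply_apply, inner_smul_right]
      have := ho k n
      refine (congrArg (fun z => m n * mFourierCoeff f n * z) this).trans ?_
      by_cases h : n = k
      · subst h; simp
      · simp [h, Ne.symm h]
    simp only [e]
    exact hasSum_ite_eq k _
  have h4 := h2.unique h3
  rw [← h4, ← mFourierCoeff_toLp, ← mFourierBasis_repr, HilbertBasis.repr_apply_apply,
    coe_mFourierBasis]
  rfl

lemma memLp_continuousMap (F : C(UnitAddTorus (Fin 2), ℂ)) (p : ℝ≥0∞) :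
    MemLp F p torusMeasure :=
  MemLp.of_bound F.continuous.aestronglyMeasurable ‖F‖
    (Filter.Eventually.of_forall F.norm_coe_le_norm)

lemma lintegral_enorm_sq_smoothMultiplier_le (hm : Summable fun n => ‖m n‖)
    (hm1 : ∀ n, ‖m n‖ ≤ 1) (hf : MemLp f 2 torusMeasure) :
    ∫⁻ x, ‖smoothMultiplier m f x‖ₑ ^ 2 ∂torusMeasure ≤ ∫⁻ x, ‖f x‖ₑ ^ 2 ∂torusMeasure := by
  rw [lintegral_enorm_sq_eq_tsum hf, lintegral_enorm_sq_eq_tsum (memLp_continuousMap _ 2)]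
  refine ENNReal.tsum_le_tsum fun n => ?_
  rw [mFourierCoeff_smoothMultiplier hm, ← ofReal_norm, ← ofReal_norm, norm_mul]
  gcongr
  exact mul_le_of_le_one_left (norm_nonneg _) (hm1 n)

/-- The multiplier is convolution with the function whose Fourier coefficients are `m`, so a sup
bound on that kernel bounds the operator from `L¹` to `L^∞`. -/
lemma enorm_smoothMultiplier_apply_le (hm : Summable fun n => ‖m n‖) {A : ℝ≥0∞}
    (hA : ∀ x, ‖∑' n, m n * mFourier n x‖ₑ ≤ A) (hf : Integrable f torusMeasure)
    (x : UnitAddTorus (Fin 2)) :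
    ‖smoothMultiplier m f x‖ₑ ≤ A * ∫⁻ y, ‖f y‖ₑ ∂torusMeasure := by
  have hint : ∀ n, Integrable (fun y => m n * mFourier n (x - y) * f y) torusMeasure := fun n => by
    simp only [mFourier_sub_apply, mul_assoc]
    exact ((integrable_mFourier_mul hf (-n)).const_mul _).const_mul _
  have hnorm : ∀ n, ∫ y, ‖m n * mFourier n (x - y) * f y‖ ∂torusMeasure =
      ‖m n‖ * ∫ y, ‖f y‖ ∂torusMeasure := fun n => by
    simp only [norm_mul, norm_mFourier_apply, mul_one]
    exact integral_const_mul _ _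
  have h1 := hasSum_integral_of_summable_integral_norm hint
    (by simp only [hnorm]; exact hm.mul_right _)
  have h2 : ∀ n, ∫ y, m n * mFourier n (x - y) * f y ∂torusMeasure =
      m n * mFourierCoeff f n * mFourier n x := fun n => by
    rw [mFourierCoeff_eq_integral_torusMeasure, mul_right_comm, ← integral_const_mul]
    refine integral_congr_ae (Filter.Eventually.of_forall fun y => ?_)
    simp only [mFourier_sub_apply]
    ring
  simp only [h2] at h1
  rw [(hasSum_smoothMultiplier_apply hm f x).unique h1]
  refine (enorm_integral_le_lintegral_enorm _).trans ?_
  have hfin : AEMeasurable (fun y => ‖f y‖ₑ) torusMeasure := hf.aestronglyMeasurable.enorm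
  rw [← lintegral_const_mul'' _ hfin]
  refine lintegral_mono fun y => ?_
  rw [tsum_mul_right, enorm_mul]
  exact mul_le_mul' (hA _) le_rfl

lemma integral_smoothMultiplier_mul_conj (hm : Summable fun n => ‖m n‖)
    (f : UnitAddTorus (Fin 2) → ℂ) (hg : Integrable g torusMeasure) :
    HasSum (fun n => m n * mFourierCoeff f n * (starRingEnd ℂ) (mFourierCoeff g n))
      (∫ x, smoothMultiplier m f x * (starRingEnd ℂ) (g x) ∂torusMeasure) := by
  have hgc : Integrable (fun x => (starRingEnd ℂ) (g x)) torusMeasure :=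
    (Complex.conjLIE.toContinuousLinearEquiv : ℂ →L[ℝ] ℂ).integrable_comp hg
  have hint : ∀ n, Integrable (fun x => m n * mFourierCoeff f n * mFourier n x *
      (starRingEnd ℂ) (g x)) torusMeasure := fun n => by
    simp only [mul_assoc]
    exact ((integrable_mFourier_mul hgc n).const_mul _).const_mul _
  have hnorm : ∀ n, ∫ x, ‖m n * mFourierCoeff f n * mFourier n x * (starRingEnd ℂ) (g x)‖
      ∂torusMeasure = ‖m n * mFourierCoeff f n‖ * ∫ x, ‖g x‖ ∂torusMeasure := fun n => by
    rw [← integral_const_mul]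
    refine integral_congr_ae (Filter.Eventually.of_forall fun y => ?_)
    simp only [norm_mul, norm_mFourier_apply, mul_one, RCLike.norm_conj]
  have h1 := hasSum_integral_of_summable_integral_norm hint
    (by simp only [hnorm]; exact (summable_norm_mul_mFourierCoeff hm f).mul_right _)
  have h2 : ∀ n, ∫ x, m n * mFourierCoeff f n * mFourier n x * (starRingEnd ℂ) (g x) ∂torusMeasure
      = m n * mFourierCoeff f n * (starRingEnd ℂ) (mFourierCoeff g n) := fun n => by
    rw [mFourierCoeff_eq_integral_torusMeasure g, ← integral_conj, ← integral_const_mul]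
    refine integral_congr_ae (Filter.Eventually.of_forall fun y => ?_)
    simp only [map_mul, mFourier_neg, Complex.conj_conj]
    ring
  simp only [h2] at h1
  have h3 : ∫ x, smoothMultiplier m f x * (starRingEnd ℂ) (g x) ∂torusMeasure =
      ∫ x, ∑' n, m n * mFourierCoeff f n * mFourier n x * (starRingEnd ℂ) (g x) ∂torusMeasure := by
    refine integral_congr_ae (Filter.Eventually.of_forall fun y => ?_)
    simp only [tsum_mul_right, (hasSum_smoothMultiplier_apply hm f y).tsum_eq]
  rw [h3]
  exact h1

end SmoothMultiplier

end UnitAddTorus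

/-! ### The dispersive estimate and its norm in time. -/

lemma one_le_gaussTsum_zero (a : ℝ) : 1 ≤ gaussTsum a 0 := by
  refine le_trans (le_of_eq ?_) (ENNReal.le_tsum (0 : ℤ))
  simp

/-- The terms with `u = 0` and `k = 0` suffice. This keeps `kernelBound` nonzero, as the
interpolation theorem needs a positive norm. -/
lemma one_le_weylTheta (N t : ℝ) : 1 ≤ weylTheta N t := by
  refine le_trans ?_ (ENNReal.le_tsum (0 : ℤ))
  simpa using one_le_gaussTsum_zero _

lemma weylTheta_ne_top {N : ℝ} (hN : 1 ≤ N) (t : ℝ) : weylTheta N t ≠ ∞ :=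
  ((weylTheta_le hN t).trans_lt ENNReal.ofReal_lt_top).ne

/-- The bound for the sup norm of the kernel of the frequency-localised propagator. -/
noncomputable def kernelBound (N : ℝ) (α : Fin 2 → ℝ) (τ : ℝ) : ℝ≥0∞ :=
  ENNReal.ofReal N * (weylTheta N (α 0 * τ) * weylTheta N (α 1 * τ)) ^ (1 / 2 : ℝ)

lemma measurable_kernelBound (N : ℝ) (α : Fin 2 → ℝ) : Measurable (kernelBound N α) := by
  refine Measurable.const_mul (Measurable.pow_const (Measurable.mul ?_ ?_) _) _ <;>
  exact measurable_weylTheta.comp (measurable_const_mul _)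

open UnitAddTorus in
/-- The dispersive estimate from `L^{6/5}` to `L⁶`, in bilinear form. -/
lemma enorm_tsum_flowSymbol_mul_le {N : ℝ} (hN : 1 ≤ N) (c : Fin 2 → ℤ) (α : Fin 2 → ℝ) (τ : ℝ)
    {f g : UnitAddTorus (Fin 2) → ℂ} (hfm : Measurable f) (hf : MemLp f 2 torusMeasure)
    (hg : MemLp g 2 torusMeasure) :
    ‖∑' n, flowSymbol N c α τ n * mFourierCoeff f n * (starRingEnd ℂ) (mFourierCoeff g n)‖ₑ ≤
      (96 : ℝ≥0∞) ^ (1 / 6 : ℝ) * kernelBound N α τ ^ (2 / 3 : ℝ) *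
        ((∫⁻ x, ‖f x‖ₑ ^ (6 / 5 : ℝ) ∂torusMeasure) ^ (5 / 6 : ℝ) *
          (∫⁻ x, ‖g x‖ₑ ^ (6 / 5 : ℝ) ∂torusMeasure) ^ (5 / 6 : ℝ)) := by
  have hN0 : 0 < N := by linarith
  set m := flowSymbol N c α τ with hmdef
  have hm : Summable fun n => ‖m n‖ := by
    simp only [hmdef, norm_flowSymbol]; exact summable_gaussWeight hN0 c
  have hm1 : ∀ n, ‖m n‖ ≤ 1 := fun n => by
    rw [hmdef, norm_flowSymbol]; exact gaussWeight_le_one N c n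
  have hBtop : kernelBound N α τ ≠ ∞ :=
    ENNReal.mul_ne_top ENNReal.ofReal_ne_top (ENNReal.rpow_ne_top_of_nonneg (by norm_num)
      (ENNReal.mul_ne_top (weylTheta_ne_top hN _) (weylTheta_ne_top hN _)))
  have hBpos : kernelBound N α τ ≠ 0 := by
    refine mul_ne_zero (by simpa using hN0) ?_
    refine (ENNReal.rpow_pos_of_nonneg ?_ (by norm_num)).ne'
    exact lt_of_lt_of_le zero_lt_one (one_le_mul (one_le_weylTheta _ _) (one_le_weylTheta _ _))
  set A : ℝ := (kernelBound N α τ).toReal with hA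
  have hA0 : 0 < A := ENNReal.toReal_pos hBpos hBtop
  have hAB : ENNReal.ofReal A = kernelBound N α τ := ENNReal.ofReal_toReal hBtop
  have hint : ∀ {f : UnitAddTorus (Fin 2) → ℂ}, MemLp f 2 torusMeasure →
      Integrable f torusMeasure := fun hf => hf.integrable (by norm_num)
  have hinterp := lintegral_enorm_rpow_six_le_of_interpolation (μ := torusMeasure) hA0
    (T := fun f => smoothMultiplier m f)
    (fun f g hf hg x => smoothMultiplier_add hm (hint hf) (hint hg) x)
    (fun f hf x => by
      rw [hAB]
      exact enorm_smoothMultiplier_apply_le hm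
        (enorm_tsum_flowSymbol_mul_mFourier_le hN0 c α τ) (hint hf) x)
    (fun f hf => lintegral_enorm_sq_smoothMultiplier_le hm hm1 hf)
    (fun f _ => (smoothMultiplier m f).continuous.measurable) hfm hf
  rw [(integral_smoothMultiplier_mul_conj hm f (hint hg)).tsum_eq]
  have hconj : (6 : ℝ).HolderConjugate (6 / 5) := by
    rw [Real.holderConjugate_iff]; norm_num
  have hhold := ENNReal.lintegral_mul_le_Lp_mul_Lq torusMeasure hconj
    (smoothMultiplier m f).continuous.enorm.aemeasurable hg.1.enorm
  calc _ ≤ ∫⁻ x, ‖smoothMultiplier m f x * (starRingEnd ℂ) (g x)‖ₑ ∂torusMeasure :=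
        enorm_integral_le_lintegral_enorm _
    _ = ∫⁻ x, ‖smoothMultiplier m f x‖ₑ * ‖g x‖ₑ ∂torusMeasure := by
        refine lintegral_congr fun x => ?_
        rw [enorm_mul, ← ofReal_norm ((starRingEnd ℂ) _), RCLike.norm_conj, ofReal_norm]
    _ ≤ _ := hhold
    _ ≤ (ENNReal.ofReal (96 * A ^ 4) * (∫⁻ x, ‖f x‖ₑ ^ (6 / 5 : ℝ) ∂torusMeasure) ^ 5) ^
          (1 / 6 : ℝ) * (∫⁻ x, ‖g x‖ₑ ^ (6 / 5 : ℝ) ∂torusMeasure) ^ (1 / (6 / 5) : ℝ) :=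
        mul_le_mul' (ENNReal.rpow_le_rpow hinterp (by norm_num)) le_rfl
    _ = _ := by
        rw [ENNReal.ofReal_mul (by norm_num), ENNReal.ofReal_pow hA0.le, hAB,
          ENNReal.mul_rpow_of_nonneg _ _ (by norm_num),
          ENNReal.mul_rpow_of_nonneg _ _ (by norm_num), ← ENNReal.rpow_natCast,
          ← ENNReal.rpow_natCast, ← ENNReal.rpow_mul, ← ENNReal.rpow_mul]
        norm_num
        ring

/-- A trilinear form of Young's convolution inequality on the unit interval. -/
lemma lintegral_prod_mul_sub_le {p : ℝ} (hp : 2 ≤ p) {k G : ℝ → ℝ≥0∞} (hk : Measurable k)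
    (hG : Measurable G) :
    ∫⁻ z, k (z.2 - z.1) * (G z.1 * G z.2)
        ∂((volume.restrict (Set.Icc (0 : ℝ) 1)).prod (volume.restrict (Set.Icc (0 : ℝ) 1))) ≤
      (∫⁻ t in Set.Icc (-1 : ℝ) 1, k t ^ (p / 2)) ^ (2 / p) *
        (∫⁻ t in Set.Icc (0 : ℝ) 1, G t ^ (p / (p - 1))) ^ (2 - 2 / p) := by
  have hp0 : 0 < p := by linarith
  have hp1 : 0 < p - 1 := by linarith
  set ν := volume.restrict (Set.Icc (0 : ℝ) 1) with hν
  set I := ∫⁻ t, G t ^ (p / (p - 1)) ∂ν with hI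
  -- Differences of points of `[0, 1]` lie in `[-1, 1]`; truncating there lets the
  -- translation-invariant integral over the line be used.
  set κ : ℝ → ℝ≥0∞ := (Set.Icc (-1 : ℝ) 1).indicator fun t => k t ^ (p / 2) with hκ
  have hκm : Measurable κ := (hk.pow_const _).indicator measurableSet_Icc
  set K := ∫⁻ t, κ t with hK
  have hKeq : ∫⁻ t in Set.Icc (-1 : ℝ) 1, k t ^ (p / 2) = K :=
    (lintegral_indicator measurableSet_Icc _).symm
  have hGm : Measurable fun t => G t ^ (p / (p - 1)) := hG.pow_const _
  rw [hKeq]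
  -- The integrand is `∏ i, f i ^ e i`, and Hölder with three functions applies: their integrals are
  -- `I * I` and, for the other two, at most `I * K`.
  let f : Fin 3 → ℝ × ℝ → ℝ≥0∞ := ![fun z => G z.1 ^ (p / (p - 1)) * G z.2 ^ (p / (p - 1)),
    fun z => G z.1 ^ (p / (p - 1)) * κ (z.2 - z.1),
    fun z => κ (z.2 - z.1) * G z.2 ^ (p / (p - 1))]
  let e : Fin 3 → ℝ := ![1 - 2 / p, 1 / p, 1 / p]
  have hm0 : Measurable (f 0) := (hGm.comp measurable_fst).mul (hGm.comp measurable_snd)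
  have hm1 : Measurable (f 1) :=
    (hGm.comp measurable_fst).mul (hκm.comp (measurable_snd.sub measurable_fst))
  have hm2 : Measurable (f 2) :=
    (hκm.comp (measurable_snd.sub measurable_fst)).mul (hGm.comp measurable_snd)
  have hfm : ∀ i ∈ Finset.univ, AEMeasurable (f i) (ν.prod ν) := by
    intro i _
    fin_cases i
    exacts [hm0.aemeasurable, hm1.aemeasurable, hm2.aemeasurable]
  have h2p : 2 / p ≤ 1 := by rw [div_le_one hp0]; exact hp
  have he : ∀ i ∈ Finset.univ, 0 ≤ e i := by
    intro i _
    fin_cases i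
    · simpa [e] using h2p
    · simp [e, hp0.le]
    · simp [e, hp0.le]
  have hes : ∑ i, e i = 1 := by
    simp only [e, Fin.sum_univ_three, cons_val_zero, cons_val_one, cons_val]
    ring
  have hold := ENNReal.lintegral_prod_norm_pow_le Finset.univ hfm hes he
  have hI0 : ∫⁻ z, f 0 z ∂(ν.prod ν) = I * I :=
    lintegral_prod_mul hGm.aemeasurable hGm.aemeasurable
  have hI1 : ∫⁻ z, f 1 z ∂(ν.prod ν) ≤ I * K := by
    rw [lintegral_prod _ hm1.aemeasurable, hI, ← lintegral_mul_const _ hGm]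
    refine lintegral_mono fun t => ?_
    change ∫⁻ s, G t ^ (p / (p - 1)) * κ (s - t) ∂ν ≤ _
    have hκt : Measurable fun s => κ (s - t) := hκm.comp (by fun_prop)
    rw [lintegral_const_mul _ hκt]
    refine mul_le_mul' le_rfl ?_
    refine (setLIntegral_le_lintegral _ _).trans_eq ?_
    exact lintegral_sub_right_eq_self κ t
  have hI2 : ∫⁻ z, f 2 z ∂(ν.prod ν) ≤ I * K := by
    rw [lintegral_prod_symm _ hm2.aemeasurable, hI, ← lintegral_mul_const _ hGm]
    refine lintegral_mono fun s => ?_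
    change ∫⁻ t, κ (s - t) * G s ^ (p / (p - 1)) ∂ν ≤ _
    have hκs : Measurable fun t => κ (s - t) := hκm.comp (by fun_prop)
    rw [lintegral_mul_const _ hκs, mul_comm]
    refine mul_le_mul' le_rfl ?_
    refine (setLIntegral_le_lintegral _ _).trans_eq ?_
    exact lintegral_sub_left_eq_self κ s
  have hpt : ∫⁻ z, k (z.2 - z.1) * (G z.1 * G z.2) ∂(ν.prod ν) =
      ∫⁻ z, ∏ i, f i z ^ e i ∂(ν.prod ν) := by
    rw [hν, Measure.prod_restrict]
    refine setLIntegral_congr_fun (measurableSet_Icc.prod measurableSet_Icc) fun z hz => ?_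
    have hmem : z.2 - z.1 ∈ Set.Icc (-1 : ℝ) 1 := by
      have h1 := hz.1.1; have h2 := hz.1.2; have h3 := hz.2.1; have h4 := hz.2.2
      constructor <;> linarith
    have hκz : κ (z.2 - z.1) = k (z.2 - z.1) ^ (p / 2) := Set.indicator_of_mem hmem _
    simp only [f, e, Fin.prod_univ_three, cons_val_zero, cons_val_one, cons_val, hκz]
    have hp' : 0 ≤ 1 - 2 / p := by linarith
    have hp'' : 0 ≤ 1 / p := by positivity
    rw [ENNReal.mul_rpow_of_nonneg _ _ hp', ENNReal.mul_rpow_of_nonneg _ _ hp'',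
      ENNReal.mul_rpow_of_nonneg _ _ hp'']
    simp only [← ENNReal.rpow_mul]
    have e1 : ∀ x : ℝ≥0∞, x ^ (p / (p - 1) * (1 - 2 / p)) * x ^ (p / (p - 1) * (1 / p)) = x := by
      intro x
      rw [← ENNReal.rpow_add_of_nonneg _ _ (by positivity) (by positivity)]
      have : p / (p - 1) * (1 - 2 / p) + p / (p - 1) * (1 / p) = 1 := by field_simp; ring
      rw [this, ENNReal.rpow_one]
    have e2 : ∀ x : ℝ≥0∞, x ^ (p / 2 * (1 / p)) * x ^ (p / 2 * (1 / p)) = x := by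
      intro x
      rw [← ENNReal.rpow_add_of_nonneg _ _ (by positivity) (by positivity)]
      have : p / 2 * (1 / p) + p / 2 * (1 / p) = 1 := by field_simp; norm_num
      rw [this, ENNReal.rpow_one]
    conv_lhs => rw [← e1 (G z.1), ← e1 (G z.2), ← e2 (k (z.2 - z.1))]
    ring
  rw [hpt]
  refine hold.trans ?_
  simp only [e, Fin.prod_univ_three, cons_val_zero, cons_val_one, cons_val]
  rw [hI0]
  calc _ ≤ (I * I) ^ (1 - 2 / p) * (I * K) ^ (1 / p) * (I * K) ^ (1 / p) := by
        gcongr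
    _ = K ^ (2 / p) * I ^ (2 - 2 / p) := by
        have hp' : 0 ≤ 1 - 2 / p := by linarith
        have hp'' : 0 ≤ 1 / p := by positivity
        rw [ENNReal.mul_rpow_of_nonneg _ _ hp', ENNReal.mul_rpow_of_nonneg _ _ hp'']
        have e1 : K ^ (1 / p) * K ^ (1 / p) = K ^ (2 / p) := by
          rw [← ENNReal.rpow_add_of_nonneg _ _ hp'' hp'']; congr 1; ring
        have e2 : I ^ (1 - 2 / p) * I ^ (1 - 2 / p) * I ^ (1 / p) * I ^ (1 / p) =
            I ^ (2 - 2 / p) := by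
          rw [← ENNReal.rpow_add_of_nonneg _ _ hp' hp',
            ← ENNReal.rpow_add_of_nonneg _ _ (by positivity) hp'',
            ← ENNReal.rpow_add_of_nonneg _ _ (by positivity) hp'']
          congr 1; ring
        rw [← e1, ← e2]; ring

/-- The `L^{p/2}` norm in time of the dispersive decay rate. -/
lemma exists_lintegral_kernelBound_rpow_le {C p : ℝ} (hC : 0 < C) (hp : 6 < p) :
    ∃ D : ℝ, 0 < D ∧ ∀ (α : Fin 2 → ℝ) (N : ℝ), (∀ j, 1 / C < α j ∧ α j < C) → 1 ≤ N →
      ∫⁻ t in Set.Icc (-1 : ℝ) 1, (kernelBound N α t ^ (2 / 3 : ℝ)) ^ (p / 2) ≤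
        ENNReal.ofReal (D * N ^ (2 * p / 3 - 2)) := by
  -- The power `p / 3` of the kernel bound carries `θ^{p/6}` in each coordinate, and Cauchy–Schwarz
  -- doubles the exponent. The moment bound needs `p / 3 > 2`: this is where `p > 6` enters.
  obtain ⟨D, hD, h⟩ := exists_lintegral_weylTheta_rpow_le hC (r := p / 3) (by linarith)
  refine ⟨D, hD, fun α N hα hN => ?_⟩
  have hN0 : 0 < N := by linarith
  have hm : ∀ j, Measurable fun t => weylTheta N (α j * t) ^ (p / 6) := fun j =>
    (measurable_weylTheta.comp (measurable_const_mul (α j))).pow_const _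
  have e : ∀ t, (kernelBound N α t ^ (2 / 3 : ℝ)) ^ (p / 2) = ENNReal.ofReal (N ^ (p / 3)) *
      (weylTheta N (α 0 * t) ^ (p / 6) * weylTheta N (α 1 * t) ^ (p / 6)) := fun t => by
    rw [kernelBound, ← ENNReal.rpow_mul, ENNReal.mul_rpow_of_nonneg _ _ (by positivity),
      ← ENNReal.rpow_mul, ENNReal.mul_rpow_of_nonneg _ _ (by positivity),
      ENNReal.ofReal_rpow_of_pos hN0]
    congr 3 <;> ring_nf
  have hconj : (2 : ℝ).HolderConjugate 2 := by rw [Real.holderConjugate_iff]; norm_num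
  have hj : ∀ j, ∫⁻ t in Set.Icc (-1 : ℝ) 1, (weylTheta N (α j * t) ^ (p / 6)) ^ (2 : ℝ) ≤
      ENNReal.ofReal (D * N ^ (p / 3 - 2)) := fun j => by
    refine le_trans (le_of_eq ?_) (h (α j) N (hα j).1 (hα j).2 hN)
    refine lintegral_congr fun t => ?_
    rw [← ENNReal.rpow_mul]; congr 1; ring
  simp only [e]
  rw [lintegral_const_mul' _ _ ENNReal.ofReal_ne_top]
  calc _ ≤ ENNReal.ofReal (N ^ (p / 3)) *
        ((∫⁻ t in Set.Icc (-1 : ℝ) 1, (weylTheta N (α 0 * t) ^ (p / 6)) ^ (2 : ℝ)) ^ (1 / 2 : ℝ) *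
        (∫⁻ t in Set.Icc (-1 : ℝ) 1, (weylTheta N (α 1 * t) ^ (p / 6)) ^ (2 : ℝ)) ^ (1 / 2 : ℝ)) :=
        mul_le_mul' le_rfl (ENNReal.lintegral_mul_le_Lp_mul_Lq _ hconj (hm 0).aemeasurable
          (hm 1).aemeasurable)
    _ ≤ ENNReal.ofReal (N ^ (p / 3)) * (ENNReal.ofReal (D * N ^ (p / 3 - 2)) ^ (1 / 2 : ℝ) *
        ENNReal.ofReal (D * N ^ (p / 3 - 2)) ^ (1 / 2 : ℝ)) := by
        gcongr
        · exact hj 0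
        · exact hj 1
    _ = _ := by
        rw [← ENNReal.rpow_add_of_nonneg _ _ (by norm_num) (by norm_num)]
        norm_num
        rw [← ENNReal.ofReal_mul (by positivity)]
        congr 1
        rw [mul_left_comm, ← Real.rpow_add hN0]
        congr 2; ring

/-! ### The `TT*` argument. -/

open UnitAddTorus

lemma continuous_integral_torus {E : Type*} [NormedAddCommGroup E] [NormedSpace ℝ E]
    {f : ℝ → UnitAddTorus (Fin 2) → E}
    (hf : Continuous (Function.uncurry f)) : Continuous fun t => ∫ x, f t x ∂torusMeasure := by
  simpa only [setIntegral_univ] using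
    continuous_parametric_integral_of_continuous (μ := torusMeasure) hf isCompact_univ

lemma continuous_mFourierCoeff {F : ℝ → UnitAddTorus (Fin 2) → ℂ}
    (hF : Continuous (Function.uncurry F)) (n : Fin 2 → ℤ) :
    Continuous fun t => mFourierCoeff (F t) n := by
  simp only [mFourierCoeff_eq_integral_torusMeasure]
  refine continuous_integral_torus ?_
  exact ((mFourier (-n)).continuous.comp continuous_snd).mul hF

lemma memLp_of_continuous {f : UnitAddTorus (Fin 2) → ℂ} (hf : Continuous f) (p : ℝ≥0∞) :
    MemLp f p torusMeasure :=
  memLp_continuousMap ⟨f, hf⟩ p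

/-- The space-time Fourier coefficient of `F` over the unit time interval, along the
characteristic surface of the Schrödinger equation. -/
noncomputable def characteristicCoeff (α : Fin 2 → ℝ) (F : ℝ → UnitAddTorus (Fin 2) → ℂ)
    (n : Fin 2 → ℤ) : ℂ :=
  ∫ t in Set.Icc (0 : ℝ) 1,
    (starRingEnd ℂ) (Complex.exp (2 * Real.pi * Complex.I * (torusQ α n * t : ℝ))) *
      mFourierCoeff (F t) n

/-- The squared modulus of the time integral is a double integral whose phases combine into the
propagator at the time difference. -/
lemma gaussWeight_mul_characteristicCoeff_sq (N : ℝ) (c : Fin 2 → ℤ) (α : Fin 2 → ℝ)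
    (F : ℝ → UnitAddTorus (Fin 2) → ℂ) (n : Fin 2 → ℤ) :
    ((gaussWeight N c n * ‖characteristicCoeff α F n‖ ^ 2 : ℝ) : ℂ) =
      ∫ z, flowSymbol N c α (z.2 - z.1) n * mFourierCoeff (F z.1) n *
        (starRingEnd ℂ) (mFourierCoeff (F z.2) n)
        ∂((volume.restrict (Set.Icc (0 : ℝ) 1)).prod (volume.restrict (Set.Icc (0 : ℝ) 1))) := by
  push_cast
  rw [← Complex.mul_conj', characteristicCoeff, ← integral_conj, ← integral_prod_mul,
    ← integral_const_mul]
  refine integral_congr_ae (Filter.Eventually.of_forall fun z => ?_)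
  simp only [map_mul, map_neg, neg_neg, flowSymbol, ← Complex.exp_conj, Complex.conj_ofReal,
    Complex.conj_I, map_ofNat]
  have e : Complex.exp (2 * Real.pi * Complex.I * ((torusQ α n * (z.2 - z.1) : ℝ) : ℂ)) =
      Complex.exp (2 * Real.pi * -Complex.I * ((torusQ α n * z.1 : ℝ) : ℂ)) *
        Complex.exp (2 * Real.pi * Complex.I * ((torusQ α n * z.2 : ℝ) : ℂ)) := by
    rw [← Complex.exp_add]; congr 1; push_cast; ring
  rw [e]
  ring

lemma continuous_flowSymbol (N : ℝ) (c : Fin 2 → ℤ) (α : Fin 2 → ℝ) (n : Fin 2 → ℤ) :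
    Continuous fun τ => flowSymbol N c α τ n := by
  unfold flowSymbol
  fun_prop

lemma measurable_lintegral_enorm_rpow {F : ℝ → UnitAddTorus (Fin 2) → ℂ}
    (hF : Continuous (Function.uncurry F)) (a : ℝ) :
    Measurable fun t => ∫⁻ x, ‖F t x‖ₑ ^ a ∂torusMeasure :=
  Measurable.lintegral_prod_right' (f := fun z : ℝ × UnitAddTorus (Fin 2) =>
    ‖Function.uncurry F z‖ₑ ^ a) (hF.measurable.enorm.pow_const a)

/-- The dual Strichartz estimate, obtained by the `TT*` method. -/
lemma ofReal_sum_gaussWeight_mul_characteristicCoeff_sq_le {N p : ℝ} (hN : 1 ≤ N) (hp : 2 ≤ p)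
    (c : Fin 2 → ℤ) (α : Fin 2 → ℝ) {F : ℝ → UnitAddTorus (Fin 2) → ℂ}
    (hF : Continuous (Function.uncurry F)) (s : Finset (Fin 2 → ℤ)) :
    ENNReal.ofReal (∑ n ∈ s, gaussWeight N c n * ‖characteristicCoeff α F n‖ ^ 2) ≤
      (96 : ℝ≥0∞) ^ (1 / 6 : ℝ) *
        ((∫⁻ t in Set.Icc (-1 : ℝ) 1, (kernelBound N α t ^ (2 / 3 : ℝ)) ^ (p / 2)) ^ (2 / p) *
        (∫⁻ t in Set.Icc (0 : ℝ) 1, ((∫⁻ x, ‖F t x‖ₑ ^ (6 / 5 : ℝ) ∂torusMeasure) ^ (5 / 6 : ℝ)) ^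
          (p / (p - 1))) ^ (2 - 2 / p)) := by
  have hN0 : 0 < N := by linarith
  set ν := (volume.restrict (Set.Icc (0 : ℝ) 1)).prod (volume.restrict (Set.Icc (0 : ℝ) 1)) with hν
  set Φ : (Fin 2 → ℤ) → ℝ × ℝ → ℂ := fun n z => flowSymbol N c α (z.2 - z.1) n *
    mFourierCoeff (F z.1) n * (starRingEnd ℂ) (mFourierCoeff (F z.2) n) with hΦ
  have hΦc : ∀ n, Continuous (Φ n) := fun n => by
    have h1 := continuous_flowSymbol N c α n
    have h2 := continuous_mFourierCoeff hF n
    exact ((h1.comp (continuous_snd.sub continuous_fst)).mul (h2.comp continuous_fst)).mul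
      (Complex.continuous_conj.comp (h2.comp continuous_snd))
  -- A bound on the Fourier coefficients uniform in time and frequency; with the summable Gaussian
  -- weight it justifies exchanging sum and integral.
  obtain ⟨M, hM⟩ := (isCompact_Icc (a := (0 : ℝ)) (b := 1)).exists_bound_of_continuousOn
    (continuous_integral_torus (f := fun t x => ‖F t x‖) hF.norm).continuousOn
  have hcoeff : ∀ t ∈ Set.Icc (0 : ℝ) 1, ∀ n, ‖mFourierCoeff (F t) n‖ ≤ M := fun t ht n =>
    (norm_mFourierCoeff_le n).trans ((le_abs_self _).trans (hM t ht))
  have hM0 : 0 ≤ M := (norm_nonneg _).trans (hcoeff 0 (by simp) 0)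
  have hbound : ∀ n, ∀ᵐ z ∂ν, ‖Φ n z‖ ≤ gaussWeight N c n * M ^ 2 := fun n => by
    rw [hν, Measure.prod_restrict]
    filter_upwards [ae_restrict_mem (measurableSet_Icc.prod measurableSet_Icc)] with z hz
    rw [hΦ]
    simp only [norm_mul, norm_flowSymbol, RCLike.norm_conj]
    have := hcoeff z.1 hz.1 n
    have := hcoeff z.2 hz.2 n
    have := gaussWeight_nonneg N c n
    rw [sq, mul_assoc]
    gcongr
  have hint : ∀ n, Integrable (Φ n) ν := fun n =>
    (integrable_const (gaussWeight N c n * M ^ 2)).mono' (hΦc n).aestronglyMeasurable (hbound n)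
  have hnorm : ∀ n, ∫ z, ‖Φ n z‖ ∂ν ≤ gaussWeight N c n * M ^ 2 := fun n => by
    refine (integral_mono_ae (hint n).norm (integrable_const _) (hbound n)).trans_eq ?_
    have : IsProbabilityMeasure (volume.restrict (Set.Icc (0 : ℝ) 1)) := ⟨by simp⟩
    rw [integral_const, hν, probReal_univ, one_smul]
  have hsumm : Summable fun n => ∫ z, ‖Φ n z‖ ∂ν :=
    Summable.of_nonneg_of_le (fun n => integral_nonneg fun z => norm_nonneg _) hnorm
      ((summable_gaussWeight hN0 c).mul_right _)
  have hreal := Complex.hasSum_re ((hasSum_integral_of_summable_integral_norm hint hsumm).congr_fun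
    fun n => gaussWeight_mul_characteristicCoeff_sq N c α F n)
  simp only [Complex.ofReal_re] at hreal
  have hnn : ∀ n, 0 ≤ gaussWeight N c n * ‖characteristicCoeff α F n‖ ^ 2 := fun n =>
    mul_nonneg (gaussWeight_nonneg _ _ _) (by positivity)
  have hG : Measurable fun t => (∫⁻ x, ‖F t x‖ₑ ^ (6 / 5 : ℝ) ∂torusMeasure) ^ (5 / 6 : ℝ) :=
    (measurable_lintegral_enorm_rpow hF _).pow_const _
  have hFt : ∀ t, Continuous (F t) := fun t => hF.comp (Continuous.prodMk_right t)
  calc ENNReal.ofReal (∑ n ∈ s, gaussWeight N c n * ‖characteristicCoeff α F n‖ ^ 2)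
      ≤ ENNReal.ofReal ‖∫ z, ∑' n, Φ n z ∂ν‖ := by
        refine ENNReal.ofReal_le_ofReal ?_
        -- All terms are nonnegative, so passing from `s` to all frequencies costs nothing and
        -- brings in the full kernel.
        exact (sum_le_hasSum s (fun n _ => hnn n) hreal).trans (Complex.re_le_norm _)
    _ ≤ ∫⁻ z, ‖∑' n, Φ n z‖ₑ ∂ν := by
        rw [ofReal_norm]; exact enorm_integral_le_lintegral_enorm _
    _ ≤ ∫⁻ z, (96 : ℝ≥0∞) ^ (1 / 6 : ℝ) * (kernelBound N α (z.2 - z.1) ^ (2 / 3 : ℝ) *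
        ((∫⁻ x, ‖F z.1 x‖ₑ ^ (6 / 5 : ℝ) ∂torusMeasure) ^ (5 / 6 : ℝ) *
          (∫⁻ x, ‖F z.2 x‖ₑ ^ (6 / 5 : ℝ) ∂torusMeasure) ^ (5 / 6 : ℝ))) ∂ν := by
        refine lintegral_mono fun z => ?_
        rw [← mul_assoc]
        exact enorm_tsum_flowSymbol_mul_le hN c α _ (hFt z.1).measurable
          (memLp_of_continuous (hFt z.1) 2) (memLp_of_continuous (hFt z.2) 2)
    _ ≤ _ := by
        rw [lintegral_const_mul' _ _ (ENNReal.rpow_ne_top_of_nonneg (by norm_num) (by norm_num))]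
        exact mul_le_mul' le_rfl (lintegral_prod_mul_sub_le hp
          ((measurable_kernelBound N α).pow_const _) hG)

/-! ### Duality and the `L^p_t L⁶_x` estimate. -/

/-- The solution of the Schrödinger equation with finitely many frequencies. -/
noncomputable def trigWave (α : Fin 2 → ℝ) (s : Finset (Fin 2 → ℤ)) (a : (Fin 2 → ℤ) → ℂ) (t : ℝ)
    (x : UnitAddTorus (Fin 2)) : ℂ :=
  ∑ n ∈ s, a n * Complex.exp (2 * Real.pi * Complex.I * (torusQ α n * t : ℝ)) * mFourier n x

lemma continuous_trigWave (α : Fin 2 → ℝ) (s : Finset (Fin 2 → ℤ)) (a : (Fin 2 → ℤ) → ℂ) :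
    Continuous (Function.uncurry (trigWave α s a)) := by
  unfold trigWave Function.uncurry
  fun_prop

lemma continuous_trigWave_apply (α : Fin 2 → ℝ) (s : Finset (Fin 2 → ℤ)) (a : (Fin 2 → ℤ) → ℂ)
    (t : ℝ) : Continuous (trigWave α s a t) := by
  unfold trigWave
  fun_prop

/-- Pairing a trigonometric solution with a space-time function. -/
lemma integral_conj_trigWave_mul (α : Fin 2 → ℝ) (s : Finset (Fin 2 → ℤ)) (a : (Fin 2 → ℤ) → ℂ)
    {F : ℝ → UnitAddTorus (Fin 2) → ℂ} (hF : Continuous (Function.uncurry F)) :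
    ∫ t in Set.Icc (0 : ℝ) 1, ∫ x, (starRingEnd ℂ) (trigWave α s a t x) * F t x ∂torusMeasure =
      ∑ n ∈ s, (starRingEnd ℂ) (a n) * characteristicCoeff α F n := by
  have hFt : ∀ t, Continuous (F t) := fun t => hF.comp (Continuous.prodMk_right t)
  have hin : ∀ t, ∫ x, (starRingEnd ℂ) (trigWave α s a t x) * F t x ∂torusMeasure =
      ∑ n ∈ s, (starRingEnd ℂ) (a n) *
        ((starRingEnd ℂ) (Complex.exp (2 * Real.pi * Complex.I * (torusQ α n * t : ℝ))) *
          mFourierCoeff (F t) n) := fun t => by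
    have hi : ∀ n, Integrable (fun x => mFourier (-n) x * F t x) torusMeasure := fun n =>
      integrable_mFourier_mul ((memLp_of_continuous (hFt t) 1).integrable le_rfl) _
    have : ∀ x, (starRingEnd ℂ) (trigWave α s a t x) * F t x = ∑ n ∈ s, (starRingEnd ℂ) (a n) *
        (starRingEnd ℂ) (Complex.exp (2 * Real.pi * Complex.I * (torusQ α n * t : ℝ))) *
          (mFourier (-n) x * F t x) := fun x => by
      rw [trigWave, map_sum, Finset.sum_mul]
      refine Finset.sum_congr rfl fun n _ => ?_
      rw [map_mul, map_mul, mFourier_neg, mul_assoc]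
    simp only [this]
    rw [integral_finsetSum _ fun n _ => (hi n).const_mul _]
    refine Finset.sum_congr rfl fun n _ => ?_
    rw [integral_const_mul, mFourierCoeff_eq_integral_torusMeasure, mul_assoc]
  simp only [hin]
  rw [integral_finsetSum]
  · refine Finset.sum_congr rfl fun n _ => ?_
    rw [integral_const_mul, characteristicCoeff]
  · intro n _
    refine Continuous.integrableOn_Icc ?_
    have := continuous_mFourierCoeff hF n
    fun_prop

lemma lintegral_enorm_rpow_eq_ofReal_integral {f : UnitAddTorus (Fin 2) → ℂ} (hf : Continuous f) :
    ∫⁻ x, ‖f x‖ₑ ^ (6 : ℝ) ∂torusMeasure = ENNReal.ofReal (∫ x, ‖f x‖ ^ 6 ∂torusMeasure) := by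
  have hi : Integrable (fun x => ‖f x‖ ^ 6) torusMeasure :=
    (memLp_of_continuous hf 6).integrable_norm_pow'
  rw [ofReal_integral_eq_lintegral_ofReal hi (Filter.Eventually.of_forall fun x => by positivity)]
  refine lintegral_congr fun x => ?_
  rw [← ofReal_norm, ENNReal.ofReal_rpow_of_nonneg (norm_nonneg _) (by norm_num)]
  congr 1
  rw [← Real.rpow_natCast]; norm_num

/-- The Gaussian weight is a smooth stand-in for the sharp cutoff: within `3 N` of the centre in
each coordinate it is at least `exp (-18 π)`, with `18 = 9 + 9`. -/
lemma one_le_exp_mul_gaussWeight {N : ℝ} (hN : 1 ≤ N) {c n : Fin 2 → ℤ}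
    (h : ∀ j, |(n j : ℝ) - c j| ≤ 3 * N) : 1 ≤ Real.exp (18 * Real.pi) * gaussWeight N c n := by
  have hN0 : 0 < N := by linarith
  rw [gaussWeight, ← Real.exp_add]
  refine Real.one_le_exp ?_
  have h2 : ∀ j, ((n j : ℝ) - c j) ^ 2 ≤ 9 * N ^ 2 := fun j => by
    rw [← sq_abs]
    have := pow_le_pow_left₀ (abs_nonneg _) (h j) 2
    linarith
  have e : -Real.pi / N ^ 2 * (((n 0 : ℝ) - c 0) ^ 2 + ((n 1 : ℝ) - c 1) ^ 2) =
      -(Real.pi * ((((n 0 : ℝ) - c 0) ^ 2 + ((n 1 : ℝ) - c 1) ^ 2) / N ^ 2)) := by ring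
  have h3 : (((n 0 : ℝ) - c 0) ^ 2 + ((n 1 : ℝ) - c 1) ^ 2) / N ^ 2 ≤ 18 := by
    rw [div_le_iff₀ (by positivity)]
    linarith [h2 0, h2 1]
  rw [e]
  nlinarith [Real.pi_pos]

/-- The sixth moment `∫ |f|⁶` of a function on the torus. -/
noncomputable def sixthMoment (f : UnitAddTorus (Fin 2) → ℂ) : ℝ :=
  ∫ x, ‖f x‖ ^ 6 ∂torusMeasure

lemma sixthMoment_nonneg (f : UnitAddTorus (Fin 2) → ℂ) : 0 ≤ sixthMoment f :=
  integral_nonneg fun x => by positivity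

/-- The function dual to `f` for the norm of `L^p_t L^6_x`. -/
noncomputable def dualFunction (p : ℝ) (f : UnitAddTorus (Fin 2) → ℂ) (x : UnitAddTorus (Fin 2)) :
    ℂ :=
  ((‖f x‖ ^ 4 * sixthMoment f ^ (p / 6 - 1) : ℝ) : ℂ) * f x

/-- The equality case of Hölder: the dual function's `L^{6/5}` norm to the power `p / (p - 1)` is
the `L⁶` norm of `f` to the power `p`. Hence the same time integral `I` appears on both sides of the
final inequality. -/
lemma lintegral_enorm_dualFunction_rpow {p : ℝ} (hp : 6 < p) {f : UnitAddTorus (Fin 2) → ℂ}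
    (hf : Continuous f) :
    ((∫⁻ x, ‖dualFunction p f x‖ₑ ^ (6 / 5 : ℝ) ∂torusMeasure) ^ (5 / 6 : ℝ)) ^ (p / (p - 1)) =
      ENNReal.ofReal (sixthMoment f ^ (p / 6)) := by
  have h0 := sixthMoment_nonneg f
  have hp1 : 0 < p - 1 := by linarith
  have hb : 0 ≤ sixthMoment f ^ (p / 6 - 1) := Real.rpow_nonneg h0 _
  have e1 : ∀ x, ‖dualFunction p f x‖ₑ ^ (6 / 5 : ℝ) =
      ENNReal.ofReal ((sixthMoment f ^ (p / 6 - 1)) ^ (6 / 5 : ℝ)) * ‖f x‖ₑ ^ (6 : ℝ) := fun x => by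
    have : ‖dualFunction p f x‖ = sixthMoment f ^ (p / 6 - 1) * ‖f x‖ ^ 5 := by
      rw [dualFunction, norm_mul, Complex.norm_real, Real.norm_eq_abs,
        abs_of_nonneg (mul_nonneg (by positivity) hb)]
      ring
    rw [← ofReal_norm, ← ofReal_norm, this,
      ENNReal.ofReal_rpow_of_nonneg (by positivity) (by norm_num),
      ENNReal.ofReal_rpow_of_nonneg (norm_nonneg _) (by norm_num),
      ← ENNReal.ofReal_mul (Real.rpow_nonneg hb _), Real.mul_rpow hb (by positivity),
      ← Real.rpow_natCast, ← Real.rpow_mul (norm_nonneg _)]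
    norm_num
  have e2 : sixthMoment f ^ ((p / 6 - 1) * (6 / 5)) * sixthMoment f =
      sixthMoment f ^ ((p - 1) / 5) := by
    have hne : (p / 6 - 1) * (6 / 5) + 1 ≠ 0 := by
      have : 0 < (p / 6 - 1) * (6 / 5) + 1 := by linarith
      exact this.ne'
    have := Real.rpow_add' h0 hne
    rw [Real.rpow_one] at this
    rw [← this]; congr 1; ring
  simp only [e1]
  rw [lintegral_const_mul' _ _ ENNReal.ofReal_ne_top, lintegral_enorm_rpow_eq_ofReal_integral hf,
    ← sixthMoment, ← ENNReal.ofReal_mul (Real.rpow_nonneg hb _), ← Real.rpow_mul h0, e2,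
    ← ENNReal.rpow_mul, ENNReal.ofReal_rpow_of_nonneg (Real.rpow_nonneg h0 _) (by positivity),
    ← Real.rpow_mul h0]
  congr 2
  field_simp

lemma integral_conj_mul_dualFunction {p : ℝ} (hp : 6 < p) (f : UnitAddTorus (Fin 2) → ℂ) :
    ∫ x, (starRingEnd ℂ) (f x) * dualFunction p f x ∂torusMeasure =
      ((sixthMoment f ^ (p / 6) : ℝ) : ℂ) := by
  have e1 : ∀ x, (starRingEnd ℂ) (f x) * dualFunction p f x =
      ((sixthMoment f ^ (p / 6 - 1) * ‖f x‖ ^ 6 : ℝ) : ℂ) := fun x => by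
    rw [dualFunction]
    push_cast
    linear_combination (((‖f x‖ : ℂ)) ^ 4 * ((sixthMoment f ^ (p / 6 - 1) : ℝ) : ℂ)) *
      Complex.conj_mul' (f x)
  simp only [e1]
  rw [integral_complex_ofReal, integral_const_mul, ← sixthMoment]
  have hne : p / 6 - 1 + 1 ≠ 0 := by
    have : 0 < p / 6 - 1 + 1 := by linarith
    exact this.ne'
  have := Real.rpow_add' (sixthMoment_nonneg f) hne
  rw [Real.rpow_one, sub_add_cancel] at this
  rw [← this]

/-- Closes the duality argument: combining the hypotheses bounds `I²` by a constant times `S I^{2 -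
2/p}`, and a positive real `I` can be cancelled. -/
lemma le_rpow_of_sq_le_mul {p N D I S W e k : ℝ} (hp : 2 ≤ p) (hN : 0 < N) (hD : 0 < D)
    (he : 0 < e) (hk : 0 < k) (hI0 : 0 ≤ I) (hS0 : 0 ≤ S) (hI2 : I ^ 2 ≤ S * (e * W))
    (hW : W ≤ k * ((D * N ^ (2 * p / 3 - 2)) ^ (2 / p) * I ^ (2 - 2 / p))) :
    I ≤ (√(e * k * D ^ (2 / p)) * N ^ (2 / 3 - 2 / p) * √S) ^ p := by
  have hp0 : 0 < p := by linarith
  set E := e * k * D ^ (2 / p) with hE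
  have hE0 : 0 < E := by positivity
  rcases hI0.eq_or_lt with hz | hIpos
  · rw [← hz]; positivity
  have hNpow : (D * N ^ (2 * p / 3 - 2)) ^ (2 / p) = D ^ (2 / p) * (N ^ (2 / 3 - 2 / p)) ^ 2 := by
    rw [Real.mul_rpow hD.le (by positivity), ← Real.rpow_mul hN.le, ← Real.rpow_natCast,
      ← Real.rpow_mul hN.le]
    congr 2
    push_cast
    field_simp
  have hkey : I ^ (2 / p) ≤ E * S * (N ^ (2 / 3 - 2 / p)) ^ 2 := by
    have hsplit : I ^ 2 = I ^ (2 / p) * I ^ (2 - 2 / p) := by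
      rw [← Real.rpow_add hIpos, ← Real.rpow_natCast]; congr 1; push_cast; ring
    refine le_of_mul_le_mul_right ?_ (Real.rpow_pos_of_pos hIpos (2 - 2 / p))
    rw [← hsplit]
    refine hI2.trans ?_
    calc S * (e * W) ≤
          S * (e * (k * ((D * N ^ (2 * p / 3 - 2)) ^ (2 / p) * I ^ (2 - 2 / p)))) := by gcongr
      _ = _ := by rw [hNpow, hE]; ring
  have hsq : E * S * (N ^ (2 / 3 - 2 / p)) ^ 2 = (√E * N ^ (2 / 3 - 2 / p) * √S) ^ 2 := by
    rw [mul_pow, mul_pow, Real.sq_sqrt hE0.le, Real.sq_sqrt hS0]; ring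
  rw [hsq] at hkey
  have hfin := Real.rpow_le_rpow (Real.rpow_nonneg hI0 _) hkey (by positivity : 0 ≤ p / 2)
  rw [← Real.rpow_mul hI0, ← Real.rpow_natCast, ← Real.rpow_mul (by positivity)] at hfin
  have e1 : 2 / p * (p / 2) = 1 := by field_simp
  have e2 : ((2 : ℕ) : ℝ) * (p / 2) = p := by push_cast; ring
  rwa [e1, e2, Real.rpow_one] at hfin

/-- The scale-invariant Strichartz estimate in `L^p_t L^6_x`, `p > 6`, for trigonometric
solutions. -/
theorem exists_lintegral_trigWave_le {C p : ℝ} (hC : 0 < C) (hp : 6 < p) :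
    ∃ c : ℝ, 0 < c ∧ ∀ α : Fin 2 → ℝ, (∀ j, 1 / C < α j ∧ α j < C) → ∀ N : ℝ, 1 ≤ N →
      ∀ (s : Finset (Fin 2 → ℤ)) (z : Fin 2 → ℤ), (∀ n ∈ s, ∀ j, |(n j : ℝ) - z j| ≤ 3 * N) →
      ∀ a : (Fin 2 → ℤ) → ℂ,
        ∫⁻ t in Set.Icc (0 : ℝ) 1,
          (∫⁻ x, ‖trigWave α s a t x‖ₑ ^ (6 : ℝ) ∂torusMeasure) ^ (p / 6) ≤
        ENNReal.ofReal ((c * N ^ (2 / 3 - 2 / p) * √(∑ n ∈ s, ‖a n‖ ^ 2)) ^ p) := by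
  obtain ⟨D, hD, hDk⟩ := exists_lintegral_kernelBound_rpow_le hC hp
  have hp0 : 0 < p := by linarith
  refine ⟨√(Real.exp (18 * Real.pi) * 96 ^ (1 / 6 : ℝ) * D ^ (2 / p)),
    by positivity, fun α hα N hN s z hs a => ?_⟩
  have hN0 : 0 < N := by linarith
  have huc : Continuous (Function.uncurry (trigWave α s a)) := continuous_trigWave α s a
  have hut : ∀ t, Continuous (trigWave α s a t) := continuous_trigWave_apply α s a
  let h : ℝ → ℝ := fun t => sixthMoment (trigWave α s a t)
  have hc : Continuous h :=
    continuous_integral_torus (f := fun t x => ‖trigWave α s a t x‖ ^ 6) (huc.norm.pow 6)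
  have h0 : ∀ t, 0 ≤ h t := fun t => sixthMoment_nonneg _
  have hpow : ∀ b : ℝ, 0 ≤ b → Continuous fun t => h t ^ b := fun b hb =>
    hc.rpow_const fun t => Or.inr hb
  let F : ℝ → UnitAddTorus (Fin 2) → ℂ := fun t => dualFunction p (trigWave α s a t)
  have hFc : Continuous (Function.uncurry F) := by
    have h1 : Continuous fun z : ℝ × UnitAddTorus (Fin 2) => h z.1 ^ (p / 6 - 1) :=
      (hpow (p / 6 - 1) (by linarith)).comp continuous_fst
    have h2 : Continuous fun z : ℝ × UnitAddTorus (Fin 2) =>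
        ‖Function.uncurry (trigWave α s a) z‖ ^ 4 * h z.1 ^ (p / 6 - 1) := (huc.norm.pow 4).mul h1
    exact (Complex.continuous_ofReal.comp h2).mul huc
  set I : ℝ := ∫ t in Set.Icc (0 : ℝ) 1, h t ^ (p / 6) with hI
  have hI0 : 0 ≤ I := integral_nonneg fun t => Real.rpow_nonneg (h0 t) _
  have hIl : ∫⁻ t in Set.Icc (0 : ℝ) 1, ENNReal.ofReal (h t ^ (p / 6)) = ENNReal.ofReal I := by
    rw [hI, ofReal_integral_eq_lintegral_ofReal ((hpow _ (by positivity)).integrableOn_Icc)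
      (Filter.Eventually.of_forall fun t => Real.rpow_nonneg (h0 t) _)]
  have hlhs : ∫⁻ t in Set.Icc (0 : ℝ) 1,
      (∫⁻ x, ‖trigWave α s a t x‖ₑ ^ (6 : ℝ) ∂torusMeasure) ^ (p / 6) = ENNReal.ofReal I := by
    rw [← hIl]
    refine lintegral_congr fun t => ?_
    rw [lintegral_enorm_rpow_eq_ofReal_integral (hut t), ← sixthMoment,
      ENNReal.ofReal_rpow_of_nonneg (h0 t) (by positivity)]
  rw [hlhs]
  have hG : ∀ t, ((∫⁻ x, ‖F t x‖ₑ ^ (6 / 5 : ℝ) ∂torusMeasure) ^ (5 / 6 : ℝ)) ^ (p / (p - 1)) =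
      ENNReal.ofReal (h t ^ (p / 6)) := fun t => lintegral_enorm_dualFunction_rpow hp (hut t)
  have hIeq : (I : ℂ) = ∑ n ∈ s, (starRingEnd ℂ) (a n) * characteristicCoeff α F n := by
    rw [← integral_conj_trigWave_mul α s a hFc, hI, ← integral_complex_ofReal]
    exact integral_congr_ae (Filter.Eventually.of_forall fun t =>
      (integral_conj_mul_dualFunction hp _).symm)
  set S : ℝ := ∑ n ∈ s, ‖a n‖ ^ 2 with hS
  have hS0 : 0 ≤ S := Finset.sum_nonneg fun n _ => by positivity
  set W : ℝ := ∑ n ∈ s, gaussWeight N z n * ‖characteristicCoeff α F n‖ ^ 2 with hW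
  have hW0 : 0 ≤ W := Finset.sum_nonneg fun n _ =>
    mul_nonneg (gaussWeight_nonneg _ _ _) (by positivity)
  have hd : ∑ n ∈ s, ‖characteristicCoeff α F n‖ ^ 2 ≤ Real.exp (18 * Real.pi) * W := by
    rw [hW, Finset.mul_sum]
    refine Finset.sum_le_sum fun n hn => ?_
    rw [← mul_assoc]
    exact le_mul_of_one_le_left (by positivity) (one_le_exp_mul_gaussWeight hN (hs n hn))
  -- Here `I` is the pairing of the wave with its dual function, thus a sum over `s`, to which
  -- Cauchy–Schwarz applies.
  have hI2 : I ^ 2 ≤ S * (Real.exp (18 * Real.pi) * W) := by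
    have h1 : I ≤ ∑ n ∈ s, ‖a n‖ * ‖characteristicCoeff α F n‖ := by
      have h2 : ‖(I : ℂ)‖ ≤ ∑ n ∈ s, ‖(starRingEnd ℂ) (a n) * characteristicCoeff α F n‖ := by
        rw [hIeq]
        exact norm_sum_le s _
      rw [Complex.norm_real, Real.norm_of_nonneg hI0] at h2
      simpa only [norm_mul, RCLike.norm_conj] using h2
    calc I ^ 2 ≤ (∑ n ∈ s, ‖a n‖ * ‖characteristicCoeff α F n‖) ^ 2 := pow_le_pow_left₀ hI0 h1 2
      _ ≤ S * ∑ n ∈ s, ‖characteristicCoeff α F n‖ ^ 2 := Finset.sum_mul_sq_le_sq_mul_sq _ _ _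
      _ ≤ _ := by gcongr
  have h2p : 0 ≤ 2 - 2 / p := by
    have : 2 / p ≤ 1 := by rw [div_le_one hp0]; linarith
    linarith
  have hWle : W ≤ 96 ^ (1 / 6 : ℝ) * ((D * N ^ (2 * p / 3 - 2)) ^ (2 / p) * I ^ (2 - 2 / p)) := by
    have hT := ofReal_sum_gaussWeight_mul_characteristicCoeff_sq_le hN (by linarith : 2 ≤ p) z α
      hFc s
    simp only [hG] at hT
    rw [hIl] at hT
    have hK := ENNReal.rpow_le_rpow (hDk α N hα hN) (by positivity : 0 ≤ 2 / p)
    have h96 : (96 : ℝ≥0∞) ^ (1 / 6 : ℝ) = ENNReal.ofReal (96 ^ (1 / 6 : ℝ)) := by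
      rw [← ENNReal.ofReal_rpow_of_nonneg (by norm_num) (by norm_num)]; norm_num
    have := hT.trans (mul_le_mul' le_rfl (mul_le_mul' hK le_rfl))
    rw [h96, ENNReal.ofReal_rpow_of_nonneg (by positivity) (by positivity),
      ENNReal.ofReal_rpow_of_nonneg hI0 h2p, ← ENNReal.ofReal_mul (by positivity),
      ← ENNReal.ofReal_mul (by positivity), ENNReal.ofReal_le_ofReal_iff (by positivity)] at this
    exact this
  exact ENNReal.ofReal_le_ofReal (le_rpow_of_sq_le_mul (by linarith) hN0 hD (Real.exp_pos _)
    (by positivity) hI0 hS0 hI2 hWle)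

/-! ### Lattice points in rotated rectangles. -/

lemma Matrix.dotProduct_mulVec_mulVec_of_mem_orthogonalGroup {O : Matrix (Fin 2) (Fin 2) ℝ}
    (hO : O ∈ Matrix.orthogonalGroup (Fin 2) ℝ) (v : Fin 2 → ℝ) :
    (O *ᵥ v) ⬝ᵥ (O *ᵥ v) = v ⬝ᵥ v := by
  have h : Oᵀ * O = 1 := (Matrix.mem_orthogonalGroup_iff' (Fin 2) ℝ).1 hO
  rw [Matrix.dotProduct_mulVec]
  conv_lhs => rw [← Matrix.vecMul_transpose, Matrix.vecMul_vecMul, h, Matrix.vecMul_one]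

lemma sq_add_sq_eq_of_mem_orthogonalGroup {O : Matrix (Fin 2) (Fin 2) ℝ}
    (hO : O ∈ Matrix.orthogonalGroup (Fin 2) ℝ) (v w : Fin 2 → ℝ) :
    ((O *ᵥ v) 0 - (O *ᵥ w) 0) ^ 2 + ((O *ᵥ v) 1 - (O *ᵥ w) 1) ^ 2 =
      (v 0 - w 0) ^ 2 + (v 1 - w 1) ^ 2 := by
  have h := Matrix.dotProduct_mulVec_mulVec_of_mem_orthogonalGroup hO (v - w)
  rw [Matrix.mulVec_sub] at h
  simp only [dotProduct, Fin.sum_univ_two, Pi.sub_apply] at h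
  linarith

lemma card_Icc_floor_le {N : ℝ} (hN : 1 ≤ N) :
    ((Finset.Icc ⌊-(2 * N)⌋ ⌊2 * N⌋).card : ℝ) ≤ 6 * N := by
  have h1 := Int.floor_le (2 * N)
  have h2 := Int.lt_floor_add_one (-(2 * N))
  have h3 : ⌊-(2 * N)⌋ ≤ ⌊2 * N⌋ := Int.floor_mono (by linarith)
  rw [Int.card_Icc, ← Int.cast_natCast, Int.toNat_of_nonneg (by linarith)]
  push_cast
  linarith

/-- A rotated rectangle contains at most `O(N M)` lattice points. -/
lemma exists_finset_of_mem_rectSets {N M : ℝ} (hM : 1 ≤ M) (hMN : M ≤ N) {R : Set (Fin 2 → ℤ)}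
    (hR : R ∈ rectSets N M) :
    ∃ s : Finset (Fin 2 → ℤ), (∀ n, n ∈ s ↔ n ∈ R) ∧ (s.card : ℝ) ≤ 36 * (N * M) ∧
      ∃ c : Fin 2 → ℤ, ∀ n ∈ s, ∀ j, |(n j : ℝ) - c j| ≤ 3 * N := by
  have hN : 1 ≤ N := hM.trans hMN
  obtain ⟨O, hO, z, hz⟩ := hR
  set y : (Fin 2 → ℤ) → Fin 2 → ℝ := fun n => O *ᵥ (fun j => (n j : ℝ)) with hy
  have hiso : ∀ n m : Fin 2 → ℤ, (y n 0 - y m 0) ^ 2 + (y n 1 - y m 1) ^ 2 =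
      ((n 0 : ℝ) - m 0) ^ 2 + ((n 1 : ℝ) - m 1) ^ 2 := fun n m =>
    sq_add_sq_eq_of_mem_orthogonalGroup hO _ _
  set T := Finset.Icc ⌊-(2 * N)⌋ ⌊2 * N⌋ ×ˢ Finset.Icc ⌊-(2 * M)⌋ ⌊2 * M⌋
  -- Boxes of side `1/2` in rotated coordinates: two points in one box have squared distance less
  -- than `1/4 + 1/4 < 1`, and rotation preserves distance, so a box holds at most one lattice
  -- point.
  set g : (Fin 2 → ℤ) → ℤ × ℤ := fun n => (⌊2 * (y n 0 + z 0)⌋, ⌊2 * (y n 1 + z 1)⌋) with hg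
  have hmaps : ∀ n ∈ R, g n ∈ T := by
    intro n hn
    obtain ⟨⟨h1, h2⟩, h3, h4⟩ := hz n hn
    refine Finset.mem_product.2 ⟨Finset.mem_Icc.2 ⟨?_, ?_⟩, Finset.mem_Icc.2 ⟨?_, ?_⟩⟩ <;>
    refine Int.floor_mono ?_ <;> simp only [hy] <;> linarith
  have hinj : Set.InjOn g R := by
    intro n _ m _ h
    have hfl : ∀ a b : ℝ, ⌊2 * a⌋ = ⌊2 * b⌋ → (a - b) ^ 2 < 1 / 4 := by
      intro a b hab
      have h1 := Int.abs_sub_lt_one_of_floor_eq_floor hab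
      rw [abs_lt] at h1
      have h2 : -(1 / 2) < a - b := by linarith [h1.1]
      have h3 : a - b < 1 / 2 := by linarith [h1.2]
      nlinarith
    have h0 := hfl _ _ (congrArg Prod.fst h)
    have h1 := hfl _ _ (congrArg Prod.snd h)
    have h2 := hiso n m
    have h3 : ((n 0 : ℝ) - m 0) ^ 2 + ((n 1 : ℝ) - m 1) ^ 2 < 1 := by
      rw [← h2]
      have e0 : y n 0 + z 0 - (y m 0 + z 0) = y n 0 - y m 0 := by ring
      have e1 : y n 1 + z 1 - (y m 1 + z 1) = y n 1 - y m 1 := by ring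
      rw [e0] at h0
      rw [e1] at h1
      linarith
    have h4 : (n 0 - m 0) ^ 2 + (n 1 - m 1) ^ 2 < 1 := by exact_mod_cast h3
    have h5 : (n 0 - m 0) ^ 2 = 0 := by nlinarith [sq_nonneg (n 0 - m 0), sq_nonneg (n 1 - m 1)]
    have h6 : (n 1 - m 1) ^ 2 = 0 := by nlinarith [sq_nonneg (n 0 - m 0), sq_nonneg (n 1 - m 1)]
    funext j
    fin_cases j
    · exact sub_eq_zero.1 (pow_eq_zero_iff (two_ne_zero) |>.1 h5)
    · exact sub_eq_zero.1 (pow_eq_zero_iff (two_ne_zero) |>.1 h6)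
  have hfin : R.Finite := Set.Finite.of_injOn hmaps hinj T.finite_toSet
  refine ⟨hfin.toFinset, fun n => hfin.mem_toFinset, ?_, ?_⟩
  · have hcard : hfin.toFinset.card ≤ T.card :=
      Finset.card_le_card_of_injOn g (fun n hn => hmaps n (hfin.mem_toFinset.1 hn))
        (fun n hn m hm => hinj (hfin.mem_toFinset.1 hn) (hfin.mem_toFinset.1 hm))
    have h1 := card_Icc_floor_le hN
    have h2 := card_Icc_floor_le hM
    calc (hfin.toFinset.card : ℝ) ≤ T.card := by exact_mod_cast hcard
      _ = (Finset.Icc ⌊-(2 * N)⌋ ⌊2 * N⌋).card * (Finset.Icc ⌊-(2 * M)⌋ ⌊2 * M⌋).card := by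
          rw [Finset.card_product]; push_cast; rfl
      _ ≤ (6 * N) * (6 * M) := by gcongr
      _ = 36 * (N * M) := by ring
  · rcases R.eq_empty_or_nonempty with h | ⟨m, hm⟩
    · exact ⟨0, fun n hn => absurd (hfin.mem_toFinset.1 hn) (by simp [h])⟩
    -- Any point of the set serves as an integral centre: two points differ by at most `2 N` in each
    -- rotated coordinate, hence by at most `√8 N ≤ 3 N` in each original one.
    · refine ⟨m, fun n hn j => ?_⟩
      obtain ⟨⟨h1, h2⟩, h3, h4⟩ := hz n (hfin.mem_toFinset.1 hn)
      obtain ⟨⟨k1, k2⟩, k3, k4⟩ := hz m hm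
      have h5 : (y n 0 - y m 0) ^ 2 ≤ (2 * N) ^ 2 :=
        sq_le_sq' (by simp only [hy]; linarith) (by simp only [hy]; linarith)
      have h6 : (y n 1 - y m 1) ^ 2 ≤ (2 * N) ^ 2 :=
        sq_le_sq' (by simp only [hy]; linarith) (by simp only [hy]; linarith)
      have h7 := hiso n m
      refine abs_le_of_sq_le_sq ?_ (by linarith)
      have h8 : 0 ≤ N ^ 2 := sq_nonneg N
      fin_cases j
      · have := sq_nonneg ((n 1 : ℝ) - m 1)
        simp only [Fin.zero_eta]
        nlinarith
      · have := sq_nonneg ((n 0 : ℝ) - m 0)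
        simp only [Fin.mk_one]
        nlinarith

/-! ### From the flow on `L²` to trigonometric sums. -/

lemma torusCoeff_eq_inner (f : L2Torus) (k : Fin 2 → ℤ) :
    torusCoeff f k = inner ℂ (torusChar k) f := by
  rw [torusCoeff, ← mFourierBasis_repr, HilbertBasis.repr_apply_apply, coe_mFourierBasis]
  rfl

lemma orthonormal_torusChar : Orthonormal ℂ torusChar := orthonormal_mFourier

lemma torusCoeff_fourierMultiplier {m : (Fin 2 → ℤ) → ℂ} {B : ℝ} (hm : ∀ n, ‖m n‖ ≤ B)
    (f : L2Torus) (k : Fin 2 → ℤ) :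
    torusCoeff (fourierMultiplier m f) k = m k * torusCoeff f k := by
  rw [torusCoeff_eq_inner (fourierMultiplier m f)]
  have h2 := (hasSum_fourierMultiplier hm f).mapL (innerSL ℂ (torusChar k))
  refine h2.unique ?_
  have e : ∀ n, innerSL ℂ (torusChar k) ((m n * torusCoeff f n) • torusChar n) =
      if n = k then m k * torusCoeff f k else 0 := by
    intro n
    rw [innerSL_apply_apply, inner_smul_right, orthonormal_iff_ite.1 orthonormal_torusChar k n]
    by_cases h : n = k
    · subst h; simp
    · simp [h, Ne.symm h]
  simp only [e]
  exact hasSum_ite_eq k _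

lemma freqProj_eq_sum {S : Set (Fin 2 → ℤ)} {s : Finset (Fin 2 → ℤ)} (hs : ∀ n, n ∈ s ↔ n ∈ S)
    (f : L2Torus) : freqProj S f = ∑ n ∈ s, torusCoeff f n • torusChar n := by
  rw [freqProj, fourierMultiplier, tsum_eq_sum (s := s)]
  · refine Finset.sum_congr rfl fun n hn => ?_
    rw [if_pos ((hs n).1 hn), one_mul]
  · intro n hn
    rw [if_neg (fun h => hn ((hs n).2 h)), zero_mul, zero_smul]

lemma torusCoeff_schrodingerFlow (α : Fin 2 → ℝ) (t : ℝ) (f : L2Torus) (n : Fin 2 → ℤ) :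
    torusCoeff (schrodingerFlow α t f) n =
      torusCoeff f n * Complex.exp (2 * Real.pi * Complex.I * (torusQ α n * t : ℝ)) := by
  rw [schrodingerFlow, torusCoeff_fourierMultiplier (fun n => (norm_exp_two_pi_I _).le), mul_comm]

lemma norm_sum_smul_torusChar (s : Finset (Fin 2 → ℤ)) (b : (Fin 2 → ℤ) → ℂ) :
    ‖∑ n ∈ s, b n • torusChar n‖ = √(∑ n ∈ s, ‖b n‖ ^ 2) := by
  have h' : ‖∑ n ∈ s, b n • torusChar n‖ ^ 2 = ∑ n ∈ s, ‖b n‖ ^ 2 := by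
    have e : ∀ n, (starRingEnd ℂ) (b n) * b n = ((‖b n‖ ^ 2 : ℝ) : ℂ) := fun n => by
      rw [Complex.conj_mul']; push_cast; rfl
    rw [← inner_self_eq_norm_sq (𝕜 := ℂ), orthonormal_torusChar.inner_sum b b s]
    simp only [e]
    rw [← Complex.ofReal_sum]
    exact Complex.ofReal_re _
  rw [← h', Real.sqrt_sq (norm_nonneg _)]

lemma sum_smul_torusChar_ae_eq (s : Finset (Fin 2 → ℤ)) (b : (Fin 2 → ℤ) → ℂ) :
    ⇑(∑ n ∈ s, b n • torusChar n) =ᵐ[torusMeasure] fun x => ∑ n ∈ s, b n * mFourier n x := by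
  have h1 : ∑ n ∈ s, b n • torusChar n =
      ContinuousMap.toLp (E := ℂ) 2 torusMeasure ℂ (∑ n ∈ s, b n • mFourier n) := by
    rw [map_sum]
    refine Finset.sum_congr rfl fun n _ => ?_
    rw [map_smul]
    rfl
  rw [h1]
  filter_upwards [ContinuousMap.coeFn_toLp torusMeasure (𝕜 := ℂ) (p := 2)
    (∑ n ∈ s, b n • mFourier n : C(UnitAddTorus (Fin 2), ℂ))] with x hx
  rw [hx]
  simp [ContinuousMap.sum_apply]

/-- For finite `S` the abstract `L²` class has an explicit continuous representative, to which the
estimates for `trigWave` apply. -/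
lemma freqProj_schrodingerFlow_ae_eq {S : Set (Fin 2 → ℤ)} {s : Finset (Fin 2 → ℤ)}
    (hs : ∀ n, n ∈ s ↔ n ∈ S) (α : Fin 2 → ℝ) (t : ℝ) (f : L2Torus) :
    ⇑(freqProj S (schrodingerFlow α t f)) =ᵐ[torusMeasure] trigWave α s (torusCoeff f) t := by
  rw [freqProj_eq_sum hs]
  simp only [torusCoeff_schrodingerFlow]
  exact sum_smul_torusChar_ae_eq s _

/-! ### Sup bounds, conservation of mass and exponents `q ≥ 6`. -/

lemma norm_trigWave_le (α : Fin 2 → ℝ) (s : Finset (Fin 2 → ℤ)) (a : (Fin 2 → ℤ) → ℂ) (t : ℝ)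
    (x : UnitAddTorus (Fin 2)) :
    ‖trigWave α s a t x‖ ≤ √s.card * √(∑ n ∈ s, ‖a n‖ ^ 2) := by
  have h1 : ‖trigWave α s a t x‖ ≤ ∑ n ∈ s, 1 * ‖a n‖ := by
    refine (norm_sum_le _ _).trans_eq (Finset.sum_congr rfl fun n _ => ?_)
    rw [norm_mul, norm_mul, norm_exp_two_pi_I, norm_mFourier_apply, mul_one, mul_one, one_mul]
  refine h1.trans ((Real.sum_mul_le_sqrt_mul_sqrt s _ _).trans_eq ?_)
  simp

/-- Parseval: the evolution multiplies each coefficient by a unimodular factor, so the mass does not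
depend on `t`. -/
lemma lintegral_enorm_sq_trigWave (α : Fin 2 → ℝ) (s : Finset (Fin 2 → ℤ))
    (a : (Fin 2 → ℤ) → ℂ) (t : ℝ) :
    ∫⁻ x, ‖trigWave α s a t x‖ₑ ^ (2 : ℝ) ∂torusMeasure =
      ENNReal.ofReal (∑ n ∈ s, ‖a n‖ ^ 2) := by
  set b : (Fin 2 → ℤ) → ℂ := fun n =>
    a n * Complex.exp (2 * Real.pi * Complex.I * (torusQ α n * t : ℝ)) with hb
  have h := norm_sum_smul_torusChar s b
  have hb' : ∀ n, ‖b n‖ = ‖a n‖ := fun n => by rw [hb, norm_mul, norm_exp_two_pi_I, mul_one]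
  simp only [hb'] at h
  have hS : 0 ≤ ∑ n ∈ s, ‖a n‖ ^ 2 := Finset.sum_nonneg fun n _ => by positivity
  have h2 := Lp.enorm_def (∑ n ∈ s, b n • torusChar n)
  rw [eLpNorm_congr_ae (sum_smul_torusChar_ae_eq s b),
    eLpNorm_eq_lintegral_rpow_enorm_toReal (by norm_num) (by norm_num), ← ofReal_norm, h] at h2
  have h3 := congrArg (· ^ (2 : ℝ)) h2
  simp only [ENNReal.toReal_ofNat] at h3
  rw [← ENNReal.rpow_mul, ENNReal.ofReal_rpow_of_nonneg (Real.sqrt_nonneg _) (by norm_num)] at h3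
  norm_num at h3
  rw [← ENNReal.ofReal_pow (Real.sqrt_nonneg _), Real.sq_sqrt hS] at h3
  rw [h3]
  refine lintegral_congr fun x => ?_
  rw [ENNReal.rpow_ofNat]
  rfl

lemma lintegral_enorm_rpow_le_of_norm_le {X : Type*} [MeasurableSpace X] {μ : Measure X}
    {f : X → ℂ} {B q r : ℝ} (hr : 0 < r) (hrq : r ≤ q) (hf : ∀ x, ‖f x‖ ≤ B) :
    ∫⁻ x, ‖f x‖ₑ ^ q ∂μ ≤ ENNReal.ofReal (B ^ (q - r)) * ∫⁻ x, ‖f x‖ₑ ^ r ∂μ := by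
  rw [← lintegral_const_mul' _ _ ENNReal.ofReal_ne_top]
  refine lintegral_mono fun x => ?_
  have h0 := norm_nonneg (f x)
  have hB : 0 ≤ B := h0.trans (hf x)
  rw [← ofReal_norm, ENNReal.ofReal_rpow_of_nonneg h0 (by linarith),
    ENNReal.ofReal_rpow_of_nonneg h0 hr.le, ← ENNReal.ofReal_mul (Real.rpow_nonneg hB _)]
  refine ENNReal.ofReal_le_ofReal ?_
  have hq : q - r + r ≠ 0 := by
    rw [sub_add_cancel]; linarith
  have e := Real.rpow_add' h0 hq
  rw [sub_add_cancel] at e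
  rw [e]
  gcongr
  exact hf x

lemma norm_trigWave_le_of_card_le {N M : ℝ} {s : Finset (Fin 2 → ℤ)}
    (hs : (s.card : ℝ) ≤ 36 * (N * M)) (α : Fin 2 → ℝ) (a : (Fin 2 → ℤ) → ℂ) (t : ℝ)
    (x : UnitAddTorus (Fin 2)) :
    ‖trigWave α s a t x‖ ≤ 6 * √(N * M) * √(∑ n ∈ s, ‖a n‖ ^ 2) := by
  refine (norm_trigWave_le α s a t x).trans ?_
  gcongr
  have e : (6 : ℝ) * √(N * M) = √(36 * (N * M)) := by
    rw [show (36 : ℝ) = 6 ^ 2 by norm_num, Real.sqrt_mul (by norm_num : (0 : ℝ) ≤ 6 ^ 2),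
      Real.sqrt_sq (by norm_num)]
  rw [e]
  exact Real.sqrt_le_sqrt hs

/-- The `L^p_t L^q_x` estimate for `p = ∞`, from the `L²` and `L^∞` bounds. -/
lemma lintegral_trigWave_rpow_le {N M q : ℝ} (hM : 1 ≤ M) (hMN : M ≤ N) (hq : 6 ≤ q)
    {s : Finset (Fin 2 → ℤ)} (hs : (s.card : ℝ) ≤ 36 * (N * M)) (α : Fin 2 → ℝ)
    (a : (Fin 2 → ℤ) → ℂ) (t : ℝ) :
    (∫⁻ x, ‖trigWave α s a t x‖ₑ ^ q ∂torusMeasure) ^ (1 / q) ≤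
      ENNReal.ofReal (6 * N ^ (1 / 2 + 1 / q) * M ^ (1 / 2 - 3 / q) *
        √(∑ n ∈ s, ‖a n‖ ^ 2)) := by
  have hM0 : 0 < M := by linarith
  have hN0 : 0 < N := by linarith
  have hq0 : 0 < q := by linarith
  set S : ℝ := ∑ n ∈ s, ‖a n‖ ^ 2 with hS
  have hS0 : 0 ≤ S := Finset.sum_nonneg fun n _ => by positivity
  have hsup : ∀ x, ‖trigWave α s a t x‖ ≤ 6 * √(N * M) * √S := norm_trigWave_le_of_card_le hs α a t
  have h := lintegral_enorm_rpow_le_of_norm_le (μ := torusMeasure) (by norm_num : (0 : ℝ) < 2)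
    (by linarith : (2 : ℝ) ≤ q) hsup
  rw [lintegral_enorm_sq_trigWave, ← hS, ← ENNReal.ofReal_mul (by positivity)] at h
  refine (ENNReal.rpow_le_rpow h (by positivity)).trans ?_
  rw [ENNReal.ofReal_rpow_of_nonneg (by positivity) (by positivity)]
  refine ENNReal.ofReal_le_ofReal ?_
  have hq1 : 2 / q ≤ 1 := by rw [div_le_one hq0]; linarith
  have hq3 : 3 / q ≤ 1 / 2 := by rw [div_le_div_iff₀ hq0 (by norm_num)]; linarith
  have e1 : ((6 * √(N * M) * √S) ^ (q - 2) * S) ^ (1 / q) =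
      6 ^ (1 - 2 / q) * (N ^ (1 / 2 - 1 / q) * M ^ (1 / 2 - 1 / q)) * √S := by
    have hS2 : S = √S ^ (2 : ℝ) := by rw [Real.rpow_two, Real.sq_sqrt hS0]
    have hsplit : √S = √S ^ (1 - 2 / q) * √S ^ (2 / q) := by
      rw [← Real.rpow_add' (Real.sqrt_nonneg _) (by simp), sub_add_cancel, Real.rpow_one]
    have hb : 0 ≤ 6 * √(N * M) * √S := by positivity
    rw [Real.mul_rpow (Real.rpow_nonneg hb _) hS0, ← Real.rpow_mul hb]
    have e2 : (q - 2) * (1 / q) = 1 - 2 / q := by field_simp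
    have e3 : S ^ (1 / q) = √S ^ (2 / q) := by
      conv_lhs => rw [hS2, ← Real.rpow_mul (Real.sqrt_nonneg _)]
      congr 1; ring
    rw [e2, e3, Real.mul_rpow (by positivity) (Real.sqrt_nonneg _),
      Real.mul_rpow (by norm_num) (Real.sqrt_nonneg _), Real.sqrt_eq_rpow (N * M),
      ← Real.rpow_mul (by positivity), Real.mul_rpow hN0.le hM0.le]
    have e4 : 1 / 2 * (1 - 2 / q) = 1 / 2 - 1 / q := by ring
    rw [e4]
    conv_rhs => rw [hsplit]
    ring
  rw [e1]
  have h6 : (6 : ℝ) ^ (1 - 2 / q) ≤ 6 := by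
    calc (6 : ℝ) ^ (1 - 2 / q) ≤ 6 ^ (1 : ℝ) :=
          Real.rpow_le_rpow_of_exponent_le (by norm_num) (by
            have : 0 ≤ 2 / q := by positivity
            linarith)
      _ = 6 := Real.rpow_one _
  -- Interpolating `L²` with `L^∞` gives the symmetric power on the left; replacing `M^{2/q}` by
  -- `N^{2/q}` gives the required form.
  have hNM : N ^ (1 / 2 - 1 / q) * M ^ (1 / 2 - 1 / q) ≤
      N ^ (1 / 2 + 1 / q) * M ^ (1 / 2 - 3 / q) := by
    have e2 : M ^ (1 / 2 - 1 / q) = M ^ (2 / q) * M ^ (1 / 2 - 3 / q) := by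
      rw [← Real.rpow_add hM0]; congr 1; ring
    have e3 : N ^ (1 / 2 + 1 / q) = N ^ (1 / 2 - 1 / q) * N ^ (2 / q) := by
      rw [← Real.rpow_add hN0]; congr 1; ring
    rw [e2, e3, mul_assoc]
    gcongr
  calc 6 ^ (1 - 2 / q) * (N ^ (1 / 2 - 1 / q) * M ^ (1 / 2 - 1 / q)) * √S
      ≤ 6 * (N ^ (1 / 2 + 1 / q) * M ^ (1 / 2 - 3 / q)) * √S := by gcongr
    _ = _ := by ring

/-- The `L^p_t L^q_x` estimate for finite `p`, interpolating between `L^{6p/q}_t L^6_x` and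
`L^∞`. -/
lemma exists_lintegral_lintegral_trigWave_le {C p q : ℝ} (hC : 0 < C) (hq : 6 ≤ q) (hqp : q < p) :
    ∃ c : ℝ, 0 < c ∧ ∀ α : Fin 2 → ℝ, (∀ j, 1 / C < α j ∧ α j < C) → ∀ N M : ℝ, 1 ≤ M → M ≤ N →
      ∀ (s : Finset (Fin 2 → ℤ)) (z : Fin 2 → ℤ), (s.card : ℝ) ≤ 36 * (N * M) →
      (∀ n ∈ s, ∀ j, |(n j : ℝ) - z j| ≤ 3 * N) → ∀ a : (Fin 2 → ℤ) → ℂ,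
        (∫⁻ t in Set.Icc (0 : ℝ) 1,
          ((∫⁻ x, ‖trigWave α s a t x‖ₑ ^ q ∂torusMeasure) ^ (1 / q)) ^ p) ^ (1 / p) ≤
        ENNReal.ofReal (c * N ^ (1 / 2 + 1 / q - 2 / p) * M ^ (1 / 2 - 3 / q) *
          √(∑ n ∈ s, ‖a n‖ ^ 2)) := by
  have hq0 : 0 < q := by linarith
  have hp0 : 0 < p := by linarith
  -- The time exponent for the `L⁶` estimate is `6 p / q`, and it exceeds `6` because `q < p`.
  have hp6 : 6 < 6 * p / q := by rw [lt_div_iff₀ hq0]; linarith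
  obtain ⟨c, hc, h⟩ := exists_lintegral_trigWave_le hC hp6
  refine ⟨6 ^ (1 - 6 / q) * c ^ (6 / q), by positivity,
    fun α hα N M hM hMN s z hcard hz a => ?_⟩
  have hM0 : 0 < M := by linarith
  have hN0 : 0 < N := by linarith
  have h0 := h α hα N (hM.trans hMN) s z hz a
  set S : ℝ := ∑ n ∈ s, ‖a n‖ ^ 2 with hS
  have hS0 : 0 ≤ S := Finset.sum_nonneg fun n _ => by positivity
  set B : ℝ := 6 * √(N * M) * √S with hB
  have hB0 : 0 ≤ B := by positivity
  have hsup : ∀ t x, ‖trigWave α s a t x‖ ≤ B := norm_trigWave_le_of_card_le hcard α a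
  have hpt : ∀ t, ((∫⁻ x, ‖trigWave α s a t x‖ₑ ^ q ∂torusMeasure) ^ (1 / q)) ^ p ≤
      ENNReal.ofReal ((B ^ (q - 6)) ^ (p / q)) *
        (∫⁻ x, ‖trigWave α s a t x‖ₑ ^ (6 : ℝ) ∂torusMeasure) ^ (6 * p / q / 6) := fun t => by
    have h1 := lintegral_enorm_rpow_le_of_norm_le (μ := torusMeasure) (by norm_num : (0 : ℝ) < 6)
      hq (hsup t)
    rw [← ENNReal.rpow_mul]
    have e : 1 / q * p = p / q := by ring
    have e' : 6 * p / q / 6 = p / q := by ring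
    rw [e, e']
    refine (ENNReal.rpow_le_rpow h1 (by positivity)).trans_eq ?_
    rw [ENNReal.mul_rpow_of_nonneg _ _ (by positivity),
      ENNReal.ofReal_rpow_of_nonneg (by positivity) (by positivity)]
  set A : ℝ := c * N ^ (2 / 3 - 2 / (6 * p / q)) * √S with hA
  have hA0 : 0 ≤ A := by positivity
  calc _ ≤ (∫⁻ t in Set.Icc (0 : ℝ) 1, ENNReal.ofReal ((B ^ (q - 6)) ^ (p / q)) *
        (∫⁻ x, ‖trigWave α s a t x‖ₑ ^ (6 : ℝ) ∂torusMeasure) ^ (6 * p / q / 6)) ^ (1 / p) :=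
        ENNReal.rpow_le_rpow (lintegral_mono hpt) (by positivity)
    _ ≤ (ENNReal.ofReal ((B ^ (q - 6)) ^ (p / q)) * ENNReal.ofReal (A ^ (6 * p / q))) ^
        (1 / p) := by
        rw [lintegral_const_mul' _ _ ENNReal.ofReal_ne_top]
        exact ENNReal.rpow_le_rpow (mul_le_mul' le_rfl h0) (by positivity)
    _ = ENNReal.ofReal (B ^ (1 - 6 / q) * A ^ (6 / q)) := by
        have e1 : (q - 6) * (p / q * (1 / p)) = 1 - 6 / q := by field_simp
        have e2 : 6 * p / q * (1 / p) = 6 / q := by field_simp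
        rw [← ENNReal.ofReal_mul (by positivity),
          ENNReal.ofReal_rpow_of_nonneg (by positivity) (by positivity),
          Real.mul_rpow (by positivity) (by positivity), ← Real.rpow_mul (by positivity),
          ← Real.rpow_mul hB0, ← Real.rpow_mul hA0, e1, e2]
    _ = _ := by
        congr 1
        have hsplit : √S = √S ^ (1 - 6 / q) * √S ^ (6 / q) := by
          rw [← Real.rpow_add' (Real.sqrt_nonneg _) (by simp), sub_add_cancel, Real.rpow_one]
        have hNe : N ^ (1 / 2 + 1 / q - 2 / p) =
            N ^ (1 / 2 * (1 - 6 / q)) * N ^ ((2 / 3 - 2 / (6 * p / q)) * (6 / q)) := by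
          rw [← Real.rpow_add hN0]
          congr 1
          field_simp
          ring
        have hMe : M ^ (1 / 2 - 3 / q) = M ^ (1 / 2 * (1 - 6 / q)) := by
          congr 1; ring
        rw [hB, hA, Real.mul_rpow (by positivity) (Real.sqrt_nonneg _),
          Real.mul_rpow (by norm_num) (Real.sqrt_nonneg _), Real.sqrt_eq_rpow (N * M),
          ← Real.rpow_mul (by positivity), Real.mul_rpow hN0.le hM0.le,
          Real.mul_rpow (by positivity) (Real.sqrt_nonneg _),
          Real.mul_rpow hc.le (by positivity), ← Real.rpow_mul hN0.le, hNe, hMe]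
        conv_rhs => rw [hsplit]
        ring

/-! ### The mixed-norm estimates. -/

/-- Strichartz estimates on rectangles in `L^p_t L^q_x` for `6 ≤ q < p ≤ ∞`. -/
theorem exists_mixedNorm_freqProj_le (C : ℝ) (hC : 0 < C) {τ₀ : Set ℝ}
    (hτ₀ : τ₀ ⊆ Set.Icc 0 1) {p q : ℝ≥0∞} (hq : 6 ≤ q) (hqp : q < p) :
    ∃ c : ℝ, 0 < c ∧ ∀ α : Fin 2 → ℝ, (∀ j, 1 / C < α j ∧ α j < C) →
      ∀ N M : ℝ, 1 ≤ M → M ≤ N → ∀ R ∈ rectSets N M, ∀ φ : L2Torus,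
        mixedNorm p q τ₀ (fun t => freqProj R (schrodingerFlow α t φ)) ≤
          ENNReal.ofReal
            (c * N ^ ((1 : ℝ) / 2 + (1 / q).toReal - (2 / p).toReal) *
              M ^ ((1 : ℝ) / 2 - (3 / q).toReal) * ‖freqProj R φ‖) := by
  have hqtop : q ≠ ∞ := (hqp.trans_le le_top).ne
  have hq0 : q ≠ 0 := (lt_of_lt_of_le (by norm_num) hq).ne'
  have hp0 : p ≠ 0 := (lt_of_le_of_lt bot_le hqp).ne'
  have hQ : 6 ≤ q.toReal := by
    have := ENNReal.toReal_mono hqtop hq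
    simpa using this
  have eq1 : (1 / q).toReal = 1 / q.toReal := by rw [ENNReal.toReal_div]; simp
  have eq3 : (3 / q).toReal = 3 / q.toReal := by rw [ENNReal.toReal_div]; simp
  -- Also valid for `p = ∞`: both sides are `0`, the right one since `∞.toReal = 0` and division by
  -- zero gives `0`.
  have ep2 : (2 / p).toReal = 2 / p.toReal := by rw [ENNReal.toReal_div]; simp
  have hnorm : ∀ (α : Fin 2 → ℝ) (R : Set (Fin 2 → ℤ)) (s : Finset (Fin 2 → ℤ)),
      (∀ n, n ∈ s ↔ n ∈ R) → ∀ (φ : L2Torus) (t : ℝ),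
      eLpNorm (freqProj R (schrodingerFlow α t φ)) q torusMeasure =
        (∫⁻ x, ‖trigWave α s (torusCoeff φ) t x‖ₑ ^ q.toReal ∂torusMeasure) ^ (1 / q.toReal) :=
    fun α R s hs φ t => by
      rw [eLpNorm_congr_ae (freqProj_schrodingerFlow_ae_eq hs α t φ),
        eLpNorm_eq_lintegral_rpow_enorm_toReal hq0 hqtop]
  have hφ : ∀ (R : Set (Fin 2 → ℤ)) (s : Finset (Fin 2 → ℤ)), (∀ n, n ∈ s ↔ n ∈ R) →
      ∀ φ : L2Torus, ‖freqProj R φ‖ = √(∑ n ∈ s, ‖torusCoeff φ n‖ ^ 2) := fun R s hs φ => by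
    rw [freqProj_eq_sum hs, norm_sum_smul_torusChar]
  rw [eq1, eq3, ep2]
  rcases eq_or_ne p ∞ with rfl | hptop
  · refine ⟨6, by norm_num, fun α _ N M hM hMN R hR φ => ?_⟩
    obtain ⟨s, hs, hcard, -⟩ := exists_finset_of_mem_rectSets hM hMN hR
    rw [mixedNorm, eLpNorm_exponent_top, hφ R s hs φ]
    refine eLpNormEssSup_le_of_ae_enorm_bound (Filter.Eventually.of_forall fun t => ?_)
    rw [enorm_eq_self, hnorm α R s hs φ t]
    simpa using lintegral_trigWave_rpow_le hM hMN hQ hcard α (torusCoeff φ) t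
  · have hQP : q.toReal < p.toReal := (ENNReal.toReal_lt_toReal hqtop hptop).2 hqp
    obtain ⟨c, hc, h⟩ := exists_lintegral_lintegral_trigWave_le hC hQ hQP
    refine ⟨c, hc, fun α hα N M hM hMN R hR φ => ?_⟩
    obtain ⟨s, hs, hcard, z, hz⟩ := exists_finset_of_mem_rectSets hM hMN hR
    rw [hφ R s hs φ]
    refine le_trans ?_ (h α hα N M hM hMN s z hcard hz (torusCoeff φ))
    rw [mixedNorm]
    -- The norm only grows when the time set is enlarged to `[0, 1]`.
    refine (eLpNorm_mono_measure _ (Measure.restrict_mono hτ₀ le_rfl)).trans_eq ?_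
    rw [eLpNorm_eq_lintegral_rpow_enorm_toReal hp0 hptop]
    simp only [enorm_eq_self, hnorm α R s hs φ]

/-- The cube estimate is the rectangle estimate with `q = 6` and `M = N`, where the exponent of `M`
vanishes and `1/2 + 1/6 = 2/3`. -/
theorem mainTheorem5 (C : ℝ) (hC : 0 < C) (τ₀ : Set ℝ) (hτ₀ : τ₀.OrdConnected)
    (hτ₀' : τ₀ ⊆ Set.Icc 0 1) (p : ℝ≥0∞) (hp : 6 < p) :
    (∃ c : ℝ, 0 < c ∧ ∀ α : Fin 2 → ℝ, (∀ j, 1 / C < α j ∧ α j < C) →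
      ∀ N : ℝ, 1 ≤ N → ∀ S ∈ cubeSets N, ∀ φ : L2Torus,
        mixedNorm p 6 τ₀ (fun t => freqProj S (schrodingerFlow α t φ)) ≤
          ENNReal.ofReal (c * N ^ ((2 : ℝ) / 3 - (2 / p).toReal) * ‖freqProj S φ‖)) ∧
    (∀ q : ℝ≥0∞, 6 ≤ q → q < p →
      ∃ c : ℝ, 0 < c ∧ ∀ α : Fin 2 → ℝ, (∀ j, 1 / C < α j ∧ α j < C) →
        ∀ N M : ℝ, 1 ≤ M → M ≤ N → ∀ R ∈ rectSets N M, ∀ φ : L2Torus,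
          mixedNorm p q τ₀ (fun t => freqProj R (schrodingerFlow α t φ)) ≤
            ENNReal.ofReal
              (c * N ^ ((1 : ℝ) / 2 + (1 / q).toReal - (2 / p).toReal) *
                M ^ ((1 : ℝ) / 2 - (3 / q).toReal) * ‖freqProj R φ‖)) := by
  refine ⟨?_, fun q hq hqp => exists_mixedNorm_freqProj_le C hC hτ₀' hq hqp⟩
  obtain ⟨c, hc, h⟩ := exists_mixedNorm_freqProj_le C hC hτ₀' le_rfl hp
  refine ⟨c, hc, fun α hα N hN S hS φ => ?_⟩
  have e1 : (1 : ℝ) / 2 + (1 / (6 : ℝ≥0∞)).toReal = 2 / 3 := by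
    rw [ENNReal.toReal_div]; norm_num
  have e2 : (1 : ℝ) / 2 - (3 / (6 : ℝ≥0∞)).toReal = 0 := by
    rw [ENNReal.toReal_div]; norm_num
  have := h α hα N N hN le_rfl S hS φ
  rwa [e1, e2, Real.rpow_zero, mul_one] at this
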